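/- Let $\Bbbk$ be an algebraically closed field of characteristic zero and fix $\mathrm{i}\in\Bbbk$ with $\mathrm{i}^2=-1$. Let $\mathcal{A}_1$ be the $\Bbbk$-algebra generated by $H_t$ ($t\in\mathbb{S}_3$) and $a_\sigma$ ($\sigma$ a transposition of $\mathbb{S}_3$) with relations $$H_e=1,\quad H_tH_s=H_{ts},\quad H_ta_\sigma=\mathrm{sgn}(t)\,a_{t\sigma t^{-1}}H_t,\quad a_\sigma^2=0,\quad a_\sigma a_\tau+a_{\sigma\tau\sigma^{-1}}a_\sigma+a_\tau a_{\sigma\tau\sigma^{-1}}=1-H_{\sigma\tau}\ \ (\sigma\ne\tau),$$ with comultiplication $\Delta(H_t)=H_t\otimes H_t$, $\Delta(a_\sigma)=H_\sigma\otimes a_\sigma+a_\sigma\otimes 1$, by which tensor products of $\mathcal{A}_1$-modules are formed. An $\mathcal{A}_1$-module is determined by its underlying $\mathbb{S}_3$-module and the action of $a_{12}$. Let $W_\epsilon$, $W_{\mathrm{sg}}$ be the trivial and the sign representation of $\mathbb{S}_3$, and $W_{\mathrm{st}}$ the standard representation with canonical basis $v,w$ in which $$[H_{12}]=\begin{pmatrix}0&1\\1&0\end{pmatrix},\quad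 [H_{23}]=\begin{pmatrix}1&0\\-1&-1\end{pmatrix},\quad [H_{13}]=\begin{pmatrix}-1&-1\\0&1\end{pmatrix}.$$ Let $S_{\mathrm{sg}}$ be $W_{\mathrm{sg}}$ with $a_{12}=0$. Let $S_{\mathrm{st}}(\theta)$, $\theta\in\{\pm\mathrm{i},\pm\frac{\mathrm{i}}3\}$, be the $\mathcal{A}_1$-module on $W_{\mathrm{st}}$ with $a_{12}v=a_{12}w=\theta(v-w)$ if $\theta=\pm\mathrm{i}$, and $a_{12}v=\theta(v+w)$, $a_{12}w=-\theta(v+w)$ if $\theta=\pm\frac{\mathrm{i}}3$. Let $M(0,2\mathrm{i},1,1,0,0)[-\mathrm{i}]$ be the $\mathcal{A}_1$-module on $W_\epsilon\oplus W_{\mathrm{sg}}\oplus W_{\mathrm{st}}$, with basis $x,y,u,t$ ($u,t$ the canonical basis of $W_{\mathrm{st}}$), given by $$a_{12}x=2\mathrm{i}(u-t),\quad a_{12}y=x+u+t,\quad a_{12}u=a_{12}t=-\mathrm{i}(u-t).$$ A projective cover of a module $M$ is a surjective homomorphism $f:Q\to M$ with $Q$ projective such that no proper submodule $N\subset Q$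 has $f(N)=M$. **Proposition.** Let $P$ be the $\Bbbk\mathbb{S}_3$-module with basis $\{x,y,u,t,v,w\}$, where $\langle x\rangle=W_\epsilon$, $\langle y\rangle=W_{\mathrm{sg}}$, $\langle u,t\rangle=W_{\mathrm{st}}$ and $\langle v,w\rangle=W_{\mathrm{st}}$ (in canonical bases). Then $P$ is an $\mathcal{A}_1$-module, in a unique way, such that $\Bbbk\{x,y,u,t\}$ is a submodule equal to $M(0,2\mathrm{i},1,1,0,0)[-\mathrm{i}]$ in the basis $x,y,u,t$, and $$a_{12}v=x-2\mathrm{i}\,y+u+t+\mathrm{i}(v-w).$$ The projection of $P$ onto the span of $v,w$ along $\Bbbk\{x,y,u,t\}$ is a homomorphism onto $S_{\mathrm{st}}(\mathrm{i})$ with kernel $\Bbbk\{x,y,u,t\}$, so that $P$ is an extension of $S_{\mathrm{st}}(\mathrm{i})$ by $M(0,2\mathrm{i},1,1,0,0)[-\mathrm{i}]$, and it is the projective cover of $S_{\mathrm{st}}(\mathrm{i})$. Moreover $P\otimes S_{\mathrm{sg}}$, $S_{\mathrm{sg}}\otimes P$ and $S_{\mathrm{sg}}\otimes P\otimes S_{\mathrm{sg}}$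 are the projective covers of $S_{\mathrm{st}}(-\frac{\mathrm{i}}3)$, $S_{\mathrm{st}}(\frac{\mathrm{i}}3)$ and $S_{\mathrm{st}}(-\mathrm{i})$, respectively. -/

import Mathlib

open scoped TensorProduct

noncomputable section

namespace PointedS3

/-! ### The symmetric group on three letters and its transpositions

The letters `1, 2, 3` are the elements `0, 1, 2` of `Fin 3`. -/

/-- The symmetric group on three letters. -/
abbrev S3 : Type := Equiv.Perm (Fin 3)

instance : DecidablePred (Equiv.Perm.IsSwap (α := Fin 3)) := fun f =>
  inferInstanceAs (Decidable (∃ x y, x ≠ y ∧ f = Equiv.swap x y))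

theorem isSwap_conj : ∀ t i : S3, i.IsSwap → (t * i * t⁻¹).IsSwap := by decide

/-- The conjugacy class of transpositions. -/
abbrev Transp : Type := {t : S3 // t.IsSwap}

/-- The action of the group on the transpositions by conjugation. -/
def conj (t : S3) (i : Transp) : Transp := ⟨t * i.1 * t⁻¹, isSwap_conj t i.1 i.2⟩

/-- The transposition `(1 2)`. -/
def s12 : Transp := ⟨Equiv.swap 0 1, by decide⟩

/-- The transposition `(2 3)`. -/
def s23 : Transp := ⟨Equiv.swap 1 2, by decide⟩

/-- The transposition `(1 3)`. -/
def s13 : Transp := ⟨Equiv.swap 0 2, by decide⟩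

/-- The sign character with values in a commutative ring. -/
def sg (k : Type*) [CommRing k] : S3 →* k :=
  ((Int.castRingHom k : ℤ →* k).comp (Units.coeHom ℤ)).comp Equiv.Perm.sign

/-! ### The algebra `𝒜_λ` -/

/-- The generators `H_t`, `a_i` of the algebra `𝒜_λ`. -/
inductive Gen : Type
  | H : S3 → Gen
  | a : Transp → Gen

section Algebra

variable {k : Type*} [Field k]

/-- The generator `H_t` in the free algebra. -/
def fH (t : S3) : FreeAlgebra k Gen := FreeAlgebra.ι k (Gen.H t)

/-- The generator `a_i` in the free algebra. -/
def fa (i : Transp) : FreeAlgebra k Gen := FreeAlgebra.ι k (Gen.a i)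

/-- The defining relations of `𝒜_λ`. -/
inductive Rel (l : k) : FreeAlgebra k Gen → FreeAlgebra k Gen → Prop
  | one : Rel l (fH 1) 1
  | mul (t s : S3) : Rel l (fH t * fH s) (fH (t * s))
  | comm (t : S3) (i : Transp) : Rel l (fH t * fa i) (sg k t • (fa (conj t i) * fH t))
  | sq (i : Transp) : Rel l (fa i * fa i) 0
  | quad (i j : Transp) (h : i ≠ j) :
      Rel l (fa i * fa j + fa (conj i.1 j) * fa i + fa j * fa (conj i.1 j))
        (l • (1 - fH (i.1 * j.1)))

/-- The algebra `𝒜_λ`. -/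
def Alg (l : k) : Type _ := RingQuot (Rel l)

instance (l : k) : Ring (Alg l) := inferInstanceAs (Ring (RingQuot (Rel l)))

instance (l : k) : Algebra k (Alg l) := inferInstanceAs (Algebra k (RingQuot (Rel l)))

/-- The quotient map from the free algebra. -/
def Alg.mk (l : k) : FreeAlgebra k Gen →ₐ[k] Alg l := RingQuot.mkAlgHom k (Rel l)

/-- The generator `H_t` of `𝒜_λ`. -/
def Alg.H (l : k) (t : S3) : Alg l := Alg.mk l (fH t)

/-- The generator `a_i` of `𝒜_λ`. -/
def Alg.a (l : k) (i : Transp) : Alg l := Alg.mk l (fa i)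

theorem Alg.H_one (l : k) : Alg.H l 1 = 1 :=
  (RingQuot.mkAlgHom_rel k (Rel.one (l := l))).trans (map_one (Alg.mk l))

theorem Alg.H_mul (l : k) (t s : S3) : Alg.H l t * Alg.H l s = Alg.H l (t * s) :=
  (map_mul (Alg.mk l) _ _).symm.trans (RingQuot.mkAlgHom_rel k (Rel.mul (l := l) t s))

theorem Alg.H_a (l : k) (t : S3) (i : Transp) :
    Alg.H l t * Alg.a l i = sg k t • (Alg.a l (conj t i) * Alg.H l t) := by
  have h : Alg.mk l _ = Alg.mk l _ := RingQuot.mkAlgHom_rel k (Rel.comm (l := l) t i)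
  simp only [map_mul, map_smul] at h
  exact h

theorem Alg.a_sq (l : k) (i : Transp) : Alg.a l i * Alg.a l i = 0 := by
  have h : Alg.mk l _ = Alg.mk l _ := RingQuot.mkAlgHom_rel k (Rel.sq (l := l) i)
  simp only [map_mul, map_zero] at h
  exact h

theorem Alg.a_quad (l : k) (i j : Transp) (hij : i ≠ j) :
    Alg.a l i * Alg.a l j + Alg.a l (conj i.1 j) * Alg.a l i + Alg.a l j * Alg.a l (conj i.1 j)
      = l • (1 - Alg.H l (i.1 * j.1)) := by
  have h : Alg.mk l _ = Alg.mk l _ := RingQuot.mkAlgHom_rel k (Rel.quad (l := l) i j hij)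
  simp only [map_mul, map_add, map_sub, map_one, map_smul] at h
  exact h

/-- The universal property of `𝒜_λ`. -/
def Alg.lift (l : k) {B : Type*} [Ring B] [Algebra k B] (σ : S3 →* B) (T : Transp → B)
    (h_comm : ∀ t i, σ t * T i = sg k t • (T (conj t i) * σ t))
    (h_sq : ∀ i, T i * T i = 0)
    (h_quad : ∀ i j : Transp, i ≠ j →
      T i * T j + T (conj i.1 j) * T i + T j * T (conj i.1 j) = l • (1 - σ (i.1 * j.1))) :
    Alg l →ₐ[k] B :=
  RingQuot.liftAlgHom k ⟨FreeAlgebra.lift k (fun g => match g with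
    | Gen.H t => σ t
    | Gen.a i => T i), by
      intro x y h
      cases h with
      | one => simp [fH]
      | mul t s => simp [fH]
      | comm t i => simpa [fH, fa] using h_comm t i
      | sq i => simpa [fa] using h_sq i
      | quad i j hij => simpa [fH, fa] using h_quad i j hij⟩

section lift

variable (l : k) {B : Type*} [Ring B] [Algebra k B] (σ : S3 →* B) (T : Transp → B)
    (h_comm : ∀ t i, σ t * T i = sg k t • (T (conj t i) * σ t))
    (h_sq : ∀ i, T i * T i = 0)
    (h_quad : ∀ i j : Transp, i ≠ j →
      T i * T j + T (conj i.1 j) * T i + T j * T (conj i.1 j) = l • (1 - σ (i.1 * j.1)))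

@[simp]
theorem Alg.lift_H (t : S3) : Alg.lift l σ T h_comm h_sq h_quad (Alg.H l t) = σ t := by
  refine (RingQuot.liftAlgHom_mkAlgHom_apply k _ _ _).trans ?_
  simp [fH]

@[simp]
theorem Alg.lift_a (i : Transp) : Alg.lift l σ T h_comm h_sq h_quad (Alg.a l i) = T i := by
  refine (RingQuot.liftAlgHom_mkAlgHom_apply k _ _ _).trans ?_
  simp [fa]

end lift

theorem Alg.hom_ext (l : k) {B : Type*} [Ring B] [Algebra k B] {f g : Alg l →ₐ[k] B}
    (hH : ∀ t, f (Alg.H l t) = g (Alg.H l t)) (ha : ∀ i, f (Alg.a l i) = g (Alg.a l i)) :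
    f = g := by
  refine RingQuot.ringQuot_ext' k (s := Rel l) f g (FreeAlgebra.hom_ext (funext fun x => ?_))
  cases x with
  | H t => exact hH t
  | a i => exact ha i

/-! ### The bialgebra structure of `𝒜_λ` -/

/-- `H` as a homomorphism of monoids. -/
def Alg.Hhom (l : k) : S3 →* Alg l where
  toFun := Alg.H l
  map_one' := Alg.H_one l
  map_mul' t s := (Alg.H_mul l t s).symm

theorem sg_transp (i : Transp) : sg k i.1 = -1 := by
  have : Equiv.Perm.sign i.1 = -1 := i.2.sign_eq
  simp [sg, this]

theorem conj_self : ∀ i : Transp, conj i.1 i = i := by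
  rintro ⟨i, hi⟩; simp [conj]

set_option maxRecDepth 10000 in
theorem conj_facts : ∀ i j : S3, i.IsSwap → j.IsSwap → i ≠ j →
    i * j * i⁻¹ * i = i * j ∧ j * (i * j * i⁻¹) = i * j ∧
    (i * j * i⁻¹) * i * (i * j * i⁻¹)⁻¹ = j ∧ j * (i * j * i⁻¹) * j⁻¹ = i := by decide

/-- The comultiplication: `Δ(H_t) = H_t ⊗ H_t`, `Δ(a_i) = H_i ⊗ a_i + a_i ⊗ 1`. -/
def Alg.comul (l : k) : Alg l →ₐ[k] Alg l ⊗[k] Alg l :=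
  Alg.lift l
    { toFun := fun t => Alg.H l t ⊗ₜ[k] Alg.H l t
      map_one' := by rw [Alg.H_one, Algebra.TensorProduct.one_def]
      map_mul' := fun t s => by simp [Alg.H_mul] }
    (fun i => Alg.H l i.1 ⊗ₜ[k] Alg.a l i + Alg.a l i ⊗ₜ[k] 1)
    (by
      intro t i
      have e : (conj t i).1 * t = t * i.1 := by simp [conj]
      simp only [MonoidHom.coe_mk, OneHom.coe_mk, mul_add, add_mul,
        Algebra.TensorProduct.tmul_mul_tmul, Alg.H_mul, Alg.H_a, e, mul_one, one_mul, smul_add,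
        TensorProduct.tmul_smul, TensorProduct.smul_tmul'])
    (by
      intro i
      have e : Alg.H l i.1 * Alg.a l i = -(Alg.a l i * Alg.H l i.1) := by
        rw [Alg.H_a, sg_transp, conj_self, neg_one_smul]
      simp only [mul_add, add_mul, Algebra.TensorProduct.tmul_mul_tmul, Alg.a_sq, e, mul_one,
        one_mul, TensorProduct.tmul_zero, TensorProduct.zero_tmul, TensorProduct.neg_tmul]
      abel)
    (by
      intro i j hij
      obtain ⟨f1, f2, f3, f4⟩ := conj_facts i.1 j.1 i.2 j.2 (fun h => hij (Subtype.ext h))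
      set m := conj i.1 j with hm
      have g1 : m.1 * i.1 = i.1 * j.1 := f1
      have g2 : j.1 * m.1 = i.1 * j.1 := f2
      have g3 : conj m.1 i = j := Subtype.ext f3
      have g4 : conj j.1 m = i := Subtype.ext f4
      have e1 : Alg.H l i.1 * Alg.a l j = -(Alg.a l m * Alg.H l i.1) := by
        rw [Alg.H_a, sg_transp, ← hm, neg_one_smul]
      have e2 : Alg.H l m.1 * Alg.a l i = -(Alg.a l j * Alg.H l m.1) := by
        rw [Alg.H_a, sg_transp, g3, neg_one_smul]
      have e3 : Alg.H l j.1 * Alg.a l m = -(Alg.a l i * Alg.H l j.1) := by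
        rw [Alg.H_a, sg_transp, g4, neg_one_smul]
      have q := Alg.a_quad l i j hij
      rw [← hm] at q
      have q1 : (Alg.H l (i.1 * j.1)) ⊗ₜ[k] (Alg.a l i * Alg.a l j)
          + (Alg.H l (i.1 * j.1)) ⊗ₜ[k] (Alg.a l m * Alg.a l i)
          + (Alg.H l (i.1 * j.1)) ⊗ₜ[k] (Alg.a l j * Alg.a l m)
          = (Alg.H l (i.1 * j.1)) ⊗ₜ[k] (l • (1 - Alg.H l (i.1 * j.1))) := by
        rw [← q, TensorProduct.tmul_add, TensorProduct.tmul_add]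
      have q2 : (Alg.a l i * Alg.a l j) ⊗ₜ[k] (1 : Alg l)
          + (Alg.a l m * Alg.a l i) ⊗ₜ[k] (1 : Alg l)
          + (Alg.a l j * Alg.a l m) ⊗ₜ[k] (1 : Alg l)
          = (l • (1 - Alg.H l (i.1 * j.1))) ⊗ₜ[k] (1 : Alg l) := by
        rw [← q, TensorProduct.add_tmul, TensorProduct.add_tmul]
      have q3 : l • (1 - Alg.H l (i.1 * j.1) ⊗ₜ[k] Alg.H l (i.1 * j.1))
          = (Alg.H l (i.1 * j.1)) ⊗ₜ[k] (l • (1 - Alg.H l (i.1 * j.1)))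
            + (l • (1 - Alg.H l (i.1 * j.1))) ⊗ₜ[k] (1 : Alg l) := by
        rw [TensorProduct.tmul_smul, ← TensorProduct.smul_tmul', ← smul_add,
          TensorProduct.tmul_sub, TensorProduct.sub_tmul, Algebra.TensorProduct.one_def]
        congr 1
        abel
      simp only [MonoidHom.coe_mk, OneHom.coe_mk]
      rw [q3, ← q1, ← q2]
      simp only [mul_add, add_mul, Algebra.TensorProduct.tmul_mul_tmul, Alg.H_mul, g1, g2,
        e1, e2, e3, mul_one, one_mul, TensorProduct.neg_tmul]
      abel)

/-- The counit: `ε(H_t) = 1`, `ε(a_i) = 0`. -/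
def Alg.counit (l : k) : Alg l →ₐ[k] k :=
  Alg.lift l 1 (fun _ => 0) (by simp) (by simp) (by simp)

@[simp]
theorem Alg.comul_H (l : k) (t : S3) : Alg.comul l (Alg.H l t) = Alg.H l t ⊗ₜ[k] Alg.H l t := by
  simp [Alg.comul]

@[simp]
theorem Alg.comul_a (l : k) (i : Transp) :
    Alg.comul l (Alg.a l i) = Alg.H l i.1 ⊗ₜ[k] Alg.a l i + Alg.a l i ⊗ₜ[k] 1 := by
  simp [Alg.comul]

@[simp]
theorem Alg.counit_H (l : k) (t : S3) : Alg.counit l (Alg.H l t) = 1 := by simp [Alg.counit]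

@[simp]
theorem Alg.counit_a (l : k) (i : Transp) : Alg.counit l (Alg.a l i) = 0 := by simp [Alg.counit]

instance (l : k) : Bialgebra k (Alg l) :=
  Bialgebra.ofAlgHom (Alg.comul l) (Alg.counit l)
    (by
      refine Alg.hom_ext l (fun t => by simp) (fun i => ?_)
      simp [TensorProduct.add_tmul, TensorProduct.tmul_add, add_assoc,
        Algebra.TensorProduct.one_def])
    (by refine Alg.hom_ext l (fun t => by simp) (fun i => by simp))
    (by refine Alg.hom_ext l (fun t => by simp) (fun i => by simp))

end Algebra

/-! ### Modules, tensor products and projective covers -/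

section Modules

variable {k : Type*} [Field k]

/-- The module over the `k`-algebra `A` that is given by a representation `ρ : A → End V`. -/
def RepMod {A V : Type*} [Ring A] [Algebra k A] [AddCommGroup V] [Module k V]
    (_ρ : A →ₐ[k] Module.End k V) : Type _ := V

section RepMod

variable {A V : Type*} [Ring A] [Algebra k A] [AddCommGroup V] [Module k V]
    (ρ : A →ₐ[k] Module.End k V)

instance : AddCommGroup (RepMod ρ) := inferInstanceAs (AddCommGroup V)

instance : Module k (RepMod ρ) := inferInstanceAs (Module k V)

instance : Module A (RepMod ρ) := Module.compHom V ρ.toRingHom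

/-- The identity map, from the vector space to the module that it carries. -/
def RepMod.of : V ≃ₗ[k] RepMod ρ := LinearEquiv.refl k V

theorem RepMod.smul_of (a : A) (v : V) : a • RepMod.of ρ v = RepMod.of ρ (ρ a v) := rfl

end RepMod

/-- The tensor product of two representations of a bialgebra. -/
def tensorRep {A V W : Type*} [Ring A] [Bialgebra k A] [AddCommGroup V] [Module k V]
    [AddCommGroup W] [Module k W] (ρ : A →ₐ[k] Module.End k V) (σ : A →ₐ[k] Module.End k W) :
    A →ₐ[k] Module.End k (V ⊗[k] W) :=
  Module.endTensorEndAlgHom.comp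
    ((Algebra.TensorProduct.map ρ σ).comp (Bialgebra.comulAlgHom k A))

/-- `f : P → M` is a projective cover: `P` is projective and `f` is an essential surjection. -/
structure IsProjectiveCover {B P M : Type*} [Ring B] [AddCommGroup P] [Module B P]
    [AddCommGroup M] [Module B M] (f : P →ₗ[B] M) : Prop where
  projective : Module.Projective B P
  surjective : Function.Surjective f
  essential : ∀ N : Submodule B P, N.map f = ⊤ → N = ⊤

end Modules

/-! ### Representations of `𝒜_λ` that are determined by the group and `a_{12}` -/

section Reps

variable {k : Type*} [Field k]

set_option maxRecDepth 10000 in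
theorem exists_centralizing : ∀ t i : S3, i.IsSwap → ∃ c : S3,
    ((c = 1 ∧ Equiv.Perm.sign t = 1) ∨ (c = s12.1 ∧ Equiv.Perm.sign t = -1)) ∧
    t * (s12.1 * i) = s12.1 * (t * i * t⁻¹) * c ∧
    c * (i * s12.1) = (t * i * t⁻¹) * s12.1 * t := by decide

set_option maxRecDepth 10000 in
theorem exists_conj_pair : ∀ i j : S3, i.IsSwap → j.IsSwap → i ≠ j →
    ∃ t : S3, t * s12.1 * t⁻¹ = i ∧ t * s23.1 * t⁻¹ = j := by decide

/-- The image of `a_i`, when the image of `a_{12}` is `T`: if `s = (1 2)` then the even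
permutation `s * i` conjugates `s` to `i`. -/
def conj12 {B : Type*} [Ring B] (σ : S3 →* B) (T : B) (i : Transp) : B :=
  σ (s12.1 * i.1) * T * σ (i.1 * s12.1)

section lift12

variable (l : k) {B : Type*} [Ring B] [Algebra k B] (σ : S3 →* B) (T : B)

theorem conj12_s12 : conj12 σ T s12 = T := by
  have : s12.1 * s12.1 = 1 := by decide
  simp [conj12, this]

theorem conj12_comm (h₁ : σ s12.1 * T = -(T * σ s12.1)) (t : S3) (i : Transp) :
    σ t * conj12 σ T i = sg k t • (conj12 σ T (conj t i) * σ t) := by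
  obtain ⟨c, hc, e1, e2⟩ := exists_centralizing t i.1 i.2
  have key : σ c * T = sg k t • (T * σ c) := by
    rcases hc with ⟨rfl, h⟩ | ⟨rfl, h⟩
    · simp [sg, h]
    · simp [sg, h, h₁]
  calc σ t * conj12 σ T i = σ (t * (s12.1 * i.1)) * T * σ (i.1 * s12.1) := by
        simp only [conj12, map_mul, mul_assoc]
    _ = σ (s12.1 * (conj t i).1) * (σ c * T) * σ (i.1 * s12.1) := by
        rw [e1]; simp only [conj, map_mul, mul_assoc]
    _ = sg k t • (σ (s12.1 * (conj t i).1) * T * σ (c * (i.1 * s12.1))) := by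
        rw [key]; simp only [map_mul, mul_assoc, mul_smul_comm, smul_mul_assoc]
    _ = sg k t • (conj12 σ T (conj t i) * σ t) := by
        rw [e2]; simp only [conj12, conj, map_mul, mul_assoc]

/-- The representation of `𝒜_λ` that extends the representation `σ` of the group, and in which
`a_{12}` acts by `T`. -/
def Alg.lift12 (h₁ : σ s12.1 * T = -(T * σ s12.1)) (h₂ : T * T = 0)
    (h₃ : T * conj12 σ T s23 + conj12 σ T s13 * T + conj12 σ T s23 * conj12 σ T s13
      = l • (1 - σ (s12.1 * s23.1))) : Alg l →ₐ[k] B :=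
  Alg.lift l σ (conj12 σ T) (conj12_comm σ T h₁)
    (by
      intro i
      have e : (i.1 * s12.1) * (s12.1 * i.1) = 1 := by
        have : ∀ i : S3, i.IsSwap → (i * s12.1) * (s12.1 * i) = 1 := by decide
        exact this i.1 i.2
      calc conj12 σ T i * conj12 σ T i
          = σ (s12.1 * i.1) * T * σ ((i.1 * s12.1) * (s12.1 * i.1)) * T * σ (i.1 * s12.1) := by
            simp only [conj12, map_mul, mul_assoc]
        _ = σ (s12.1 * i.1) * (T * T) * σ (i.1 * s12.1) := by
            rw [e, map_one]; simp only [mul_one, mul_assoc]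
        _ = 0 := by rw [h₂]; simp)
    (by
      intro i j hij
      obtain ⟨t, e1, e2⟩ := exists_conj_pair i.1 j.1 i.2 j.2 (fun h => hij (Subtype.ext h))
      obtain rfl : conj t s12 = i := Subtype.ext e1
      obtain rfl : conj t s23 = j := Subtype.ext e2
      have e3 : conj (conj t s12).1 (conj t s23) = conj t s13 := by
        apply Subtype.ext
        have : s13.1 = s12.1 * s23.1 * s12.1⁻¹ := by decide
        simp [conj, this, mul_assoc]
      have hs : sg k t * sg k t = 1 := by
        rcases Int.units_eq_one_or (Equiv.Perm.sign t) with h | h <;> simp [sg, h]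
      have ht : σ t⁻¹ * σ t = 1 := by rw [← map_mul]; simp
      have ht' : σ t * σ t⁻¹ = 1 := by rw [← map_mul]; simp
      have c : ∀ i, conj12 σ T (conj t i) = sg k t • (σ t * conj12 σ T i * σ t⁻¹) := by
        intro i
        rw [conj12_comm (k := k) σ T h₁ t i, smul_mul_assoc, smul_smul, hs, one_smul, mul_assoc,
          ht', mul_one]
      have c2 : ∀ i j, conj12 σ T (conj t i) * conj12 σ T (conj t j)
          = σ t * (conj12 σ T i * conj12 σ T j) * σ t⁻¹ := by
        intro i j
        rw [c i, c j, smul_mul_smul_comm, hs, one_smul]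
        simp only [mul_assoc]
        rw [← mul_assoc (σ t⁻¹) (σ t), ht, one_mul]
      have e4 : (conj t s12).1 * (conj t s23).1 = t * (s12.1 * s23.1) * t⁻¹ := by
        simp [conj, mul_assoc]
      rw [e3, c2, c2, c2, ← add_mul, ← add_mul, ← mul_add, ← mul_add, conj12_s12, h₃, e4,
        mul_smul_comm, smul_mul_assoc, mul_sub, sub_mul, mul_one, ht']
      simp only [map_mul])

end lift12

/-! ### The standard representation of the group -/

/-- The standard representation `W_st` over the integers, in the basis `v = e₁ - e₃`,
`w = e₂ - e₃` of the vectors of coordinate sum zero in the permutation representation. -/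
def stInt : S3 →* Matrix (Fin 2) (Fin 2) ℤ where
  toFun t := Matrix.of fun i j =>
    (if t j.castSucc = i.castSucc then 1 else 0) - (if t 2 = i.castSucc then 1 else 0)
  map_one' := by decide
  map_mul' := by decide

/-- The standard representation `W_st`, in the canonical basis `v, w`. -/
def st (k : Type*) [Field k] : S3 →* Matrix (Fin 2) (Fin 2) k :=
  ((Int.castRingHom k).mapMatrix (m := Fin 2)).toMonoidHom.comp stInt

theorem st_eq_of {t : S3} {A : Matrix (Fin 2) (Fin 2) ℤ} (h : stInt t = A) :
    st k t = A.map (Int.cast : ℤ → k) := by rw [← h]; rfl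

theorem st_s12 : st k s12.1 = !![0, 1; 1, 0] := by
  rw [st_eq_of (show stInt s12.1 = !![0, 1; 1, 0] by decide)]
  ext i j; fin_cases i <;> fin_cases j <;> simp

theorem st_s23 : st k s23.1 = !![1, 0; -1, -1] := by
  rw [st_eq_of (show stInt s23.1 = !![1, 0; -1, -1] by decide)]
  ext i j; fin_cases i <;> fin_cases j <;> simp

theorem st_s13 : st k s13.1 = !![-1, -1; 0, 1] := by
  rw [st_eq_of (show stInt s13.1 = !![-1, -1; 0, 1] by decide)]
  ext i j; fin_cases i <;> fin_cases j <;> simp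

/-- The representation `W_ε ⊕ W_sg ⊕ W_st` of the group, in the basis `x, y, v, w`. -/
def grp4 (k : Type*) [Field k] : S3 →* Matrix (Fin 4) (Fin 4) k where
  toFun t :=
    !![1, 0, 0, 0;
       0, sg k t, 0, 0;
       0, 0, st k t 0 0, st k t 0 1;
       0, 0, st k t 1 0, st k t 1 1]
  map_one' := by
    ext i j; fin_cases i <;> fin_cases j <;> simp
  map_mul' t s := by
    simp [Matrix.mul_apply (M := st k t), Fin.sum_univ_two]

/-- The representation `W_ε ⊕ W_sg ⊕ W_st ⊕ W_st` of the group, in the basis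
`x, y, u, t, v, w`. -/
def grp6 (k : Type*) [Field k] : S3 →* Matrix (Fin 6) (Fin 6) k where
  toFun t :=
    !![1, 0, 0, 0, 0, 0;
       0, sg k t, 0, 0, 0, 0;
       0, 0, st k t 0 0, st k t 0 1, 0, 0;
       0, 0, st k t 1 0, st k t 1 1, 0, 0;
       0, 0, 0, 0, st k t 0 0, st k t 0 1;
       0, 0, 0, 0, st k t 1 0, st k t 1 1]
  map_one' := by
    ext i j; fin_cases i <;> fin_cases j <;> simp
  map_mul' t s := by
    simp [Matrix.mul_apply (M := st k t), Fin.sum_univ_two]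

/-! ### The modules of `𝒜_1` -/

/-- A matrix representation, acting on column vectors. -/
def colRep {A : Type*} [Ring A] [Algebra k A] {n : ℕ} (ρ : A →ₐ[k] Matrix (Fin n) (Fin n) k) :
    A →ₐ[k] Module.End k (Fin n → k) :=
  (Matrix.toLinAlgEquiv' : Matrix (Fin n) (Fin n) k ≃ₐ[k] _).toAlgHom.comp ρ

/-- The module supported on `W_st = k{v, w}` with `a_{12} v = c v + d w`, and hence
`a_{12} w = - d v - c w`. -/
def stMod (c d : k) (h : c ^ 2 = d ^ 2) (h' : 5 * c ^ 2 + 4 * (c * d) = -1) :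
    Alg (1 : k) →ₐ[k] Module.End k (Fin 2 → k) :=
  colRep (Alg.lift12 1 (st k) !![c, -d; d, -c]
    (by
      rw [st_s12]
      ext i j; fin_cases i <;> fin_cases j <;> simp)
    (by
      ext i j; fin_cases i <;> fin_cases j <;> simp <;> grind)
    (by
      simp only [conj12, map_mul, st_s12, st_s23, st_s13]
      ext i j; fin_cases i <;> fin_cases j <;> simp <;> grind))

/-- The module `S_st(i)`: `a_{12} v = a_{12} w = i (v - w)`. The argument `I` is `i`. -/
def SstI (I : k) (hI : I ^ 2 = -1) : Alg (1 : k) →ₐ[k] Module.End k (Fin 2 → k) :=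
  stMod I (-I) (by ring) (by linear_combination hI)

/-- The module `S_st(-i)`: `a_{12} v = a_{12} w = - i (v - w)`. -/
def SstNegI (I : k) (hI : I ^ 2 = -1) : Alg (1 : k) →ₐ[k] Module.End k (Fin 2 → k) :=
  stMod (-I) I (by ring) (by linear_combination hI)

/-- The module `S_st(i/3)`: `a_{12} v = (i/3) (v + w)`, `a_{12} w = - (i/3) (v + w)`. -/
def SstThird [CharZero k] (I : k) (hI : I ^ 2 = -1) :
    Alg (1 : k) →ₐ[k] Module.End k (Fin 2 → k) :=
  stMod (I / 3) (I / 3) rfl (by linear_combination hI)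

/-- The module `S_st(-i/3)`: `a_{12} v = - (i/3) (v + w)`, `a_{12} w = (i/3) (v + w)`. -/
def SstNegThird [CharZero k] (I : k) (hI : I ^ 2 = -1) :
    Alg (1 : k) →ₐ[k] Module.End k (Fin 2 → k) :=
  stMod (-(I / 3)) (-(I / 3)) rfl (by linear_combination hI)

/-- The one-dimensional module `S_sg`: `H_t` acts by the sign of `t` and `a_{12}` by zero. -/
def Ssg (k : Type*) [Field k] : Alg (1 : k) →ₐ[k] Module.End k k :=
  (Algebra.lmul k k).comp (Alg.lift12 1 (sg k) 0 (by simp) (by simp)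
    (by simp [conj12, sg_transp]))

/-- The matrix of `a_{12}` on `W_ε ⊕ W_sg ⊕ W_st` in the basis `x, y, v, w` with the parameters
`(α, β, γ, η, a, b)` and `a_{12} v = a x + b y + c v + d w`. -/
def mat4 (α β γ η a b c d : k) : Matrix (Fin 4) (Fin 4) k :=
  !![0, γ, a, -a;
     α, 0, b, b;
     β, η, c, -d;
     -β, η, d, -c]

theorem grp4_apply (t : S3) : grp4 k t =
    !![1, 0, 0, 0;
       0, sg k t, 0, 0;
       0, 0, st k t 0 0, st k t 0 1;
       0, 0, st k t 1 0, st k t 1 1] := rfl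

theorem grp4_s12_s23 : grp4 k (s12.1 * s23.1) =
    !![1, 0, 0, 0; 0, 1, 0, 0; 0, 0, -1, -1; 0, 0, 1, 0] := by
  rw [grp4_apply, map_mul, map_mul, st_s12, st_s23, sg_transp, sg_transp]
  simp

theorem grp4_s12_s13 : grp4 k (s12.1 * s13.1) =
    !![1, 0, 0, 0; 0, 1, 0, 0; 0, 0, 0, 1; 0, 0, -1, -1] := by
  rw [grp4_apply, map_mul, map_mul, st_s12, st_s13, sg_transp, sg_transp]
  simp

theorem mat4_s23 (I : k) : conj12 (grp4 k) (mat4 0 (2 * I) 1 1 0 0 (-I) I) s23 =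
    !![0, 1, 0, 0; 0, 0, 0, 0; 0, -2, 0, 0; 2 * I, 1, I, 0] := by
  have e : s23.1 * s12.1 = s12.1 * s13.1 := by decide
  rw [conj12, e, grp4_s12_s23, grp4_s12_s13, mat4]
  ext i j
  fin_cases i <;> fin_cases j <;> simp
  ring

theorem mat4_s13 (I : k) : conj12 (grp4 k) (mat4 0 (2 * I) 1 1 0 0 (-I) I) s13 =
    !![0, 1, 0, 0; 0, 0, 0, 0; -2 * I, 1, 0, -I; 0, -2, 0, 0] := by
  have e : s13.1 * s12.1 = s12.1 * s23.1 := by decide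
  rw [conj12, e, grp4_s12_s23, grp4_s12_s13, mat4]
  ext i j
  fin_cases i <;> fin_cases j <;> simp
  ring

theorem mat4_comm (I : k) : grp4 k s12.1 * mat4 0 (2 * I) 1 1 0 0 (-I) I =
    -(mat4 0 (2 * I) 1 1 0 0 (-I) I * grp4 k s12.1) := by
  rw [grp4_apply, st_s12, sg_transp, mat4]
  simp

theorem mat4_sq (I : k) :
    mat4 0 (2 * I) 1 1 0 0 (-I) I * mat4 0 (2 * I) 1 1 0 0 (-I) I = 0 := by
  rw [mat4]
  ext i j; fin_cases i <;> fin_cases j <;> simp <;> ring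

theorem one_fin_four :
    (1 : Matrix (Fin 4) (Fin 4) k) = !![1, 0, 0, 0; 0, 1, 0, 0; 0, 0, 1, 0; 0, 0, 0, 1] := by
  ext i j; fin_cases i <;> fin_cases j <;> rfl

theorem mat4_quad (I : k) (hI : I ^ 2 = -1) :
    mat4 0 (2 * I) 1 1 0 0 (-I) I * conj12 (grp4 k) (mat4 0 (2 * I) 1 1 0 0 (-I) I) s23
      + conj12 (grp4 k) (mat4 0 (2 * I) 1 1 0 0 (-I) I) s13 * mat4 0 (2 * I) 1 1 0 0 (-I) I
      + conj12 (grp4 k) (mat4 0 (2 * I) 1 1 0 0 (-I) I) s23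
        * conj12 (grp4 k) (mat4 0 (2 * I) 1 1 0 0 (-I) I) s13
      = (1 : k) • (1 - grp4 k (s12.1 * s23.1)) := by
  have h : I * I = -1 := by rw [← sq, hI]
  rw [mat4_s23, mat4_s13, grp4_s12_s23, mat4, one_smul, one_fin_four]
  simp [h, mul_comm]
  ring_nf
  trivial

/-- The module `M(0, 2i, 1, 1, 0, 0)[-i]`, where `c = -d = -i`. -/
def MnegI (I : k) (hI : I ^ 2 = -1) : Alg (1 : k) →ₐ[k] Module.End k (Fin 4 → k) :=
  colRep (Alg.lift12 1 (grp4 k) (mat4 0 (2 * I) 1 1 0 0 (-I) I) (mat4_comm I) (mat4_sq I)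
    (mat4_quad I hI))

/-- The inclusion of `k{x, y, u, t}` into `P = k{x, y, u, t, v, w}`. -/
def inclU (k : Type*) [Field k] : (Fin 4 → k) →ₗ[k] (Fin 6 → k) where
  toFun c := ![c 0, c 1, c 2, c 3, 0, 0]
  map_add' c d := by simp
  map_smul' r c := by simp

/-- The projection of `P = k{x, y, u, t, v, w}` onto `k{v, w}`. -/
def projVW (k : Type*) [Field k] : (Fin 6 → k) →ₗ[k] (Fin 2 → k) where
  toFun p := ![p 4, p 5]
  map_add' c d := by simp
  map_smul' r c := by simp

/-- `ρ` is an `𝒜_1`-module structure on the group representation `P` with basis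
`x, y, u, t, v, w` such that `k{x, y, u, t}` is a submodule, equal to `M(0, 2i, 1, 1, 0, 0)[-i]`
in this basis, and `a_{12} v = x - 2 i y + u + t + i (v - w)`. -/
structure IsStructureP (I : k) (hI : I ^ 2 = -1)
    (ρ : Alg (1 : k) →ₐ[k] Module.End k (Fin 6 → k)) : Prop where
  group : ∀ t : S3, ρ (Alg.H 1 t) = Matrix.toLin' (grp6 k t)
  sub : ∀ (h : Alg (1 : k)) (c : Fin 4 → k), ρ h (inclU k c) = inclU k (MnegI I hI h c)
  a12_v : ρ (Alg.a 1 s12) ![0, 0, 0, 0, 1, 0] = ![1, -2 * I, 1, 1, I, -I]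

end Reps

end PointedS3

end

open scoped TensorProduct

noncomputable section

namespace PointedS3

/-! ### Decomposing the action of `a_{12}` along the isotypic components -/

/-! Projectivity of P comes from exhibiting P as a direct summand of the regular module; the other
claims rest on matrix computations, on the fact that any vector outside $\Bbbk\{x,y,u,t,w\}$
generates P, and on sign twists. A module over $\mathcal{A}_1$ is a vector space with operators h,
g, T for $H_{12}$, $H_{23}$, $a_{12}$. Splitting into isotypic components of $\mathbb{S}_3$, a
standard component is written p + h q with p and q "first vectors" of canonical bases, so T becomes
a block of operators between multiplicity spaces. On first vectors let c and d be `fstPart` and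
`sndPart`, and put C = c + d, D = c - d. The quadratic relations of the algebra give DC = -CD, 9C² =
-4 - D² and (CD)² = 0. The last holds because CD factors through the trivial component
(`fstPart_trivPart`), where a further relation forces vanishing (`fstPart_of_isTriv`). Hence D⁴ =
-4D² (`diffPart_pow_four`), and the eigenspace of D for 2i is cut out by a polynomial in D, natural
in the module. The same relations show that a first vector v with Dv = 2iv, together with u = Cv/2,
the trivial part x of Tv and a multiple y of its sign part, satisfies the multiplication table of P
(`exists_of_eigenvector`); so v determines a homomorphism out of P. In the regular module, take v to
be the image of 1 under the projections to first vectors and to that eigenspace. The map from the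
regular module to P with 1 ↦ v sends this element to the basis vector v of P, by naturality of the
projections, so the composite fixes a generator of P and is the identity (`projective_repP`). A
submodule of P that maps onto the quotient contains a vector with v-coordinate 1, and `repP_eq_top`
makes it everything; this gives essentiality. Finally, tensoring with the sign module on the right
or left amounts to restriction along the automorphism $H_t \mapsto \mathrm{sgn}(t)H_t$, $a_\sigma
\mapsto \pm a_\sigma$, and such restriction preserves projective covers (`exists_twist`). -/

section Isotypic

variable {k N : Type*} [Field k] [AddCommGroup N] [Module k N]

/-- The relations between the operators `h`, `g`, `T` by which `H_{12}`, `H_{23}`, `a_{12}` act on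
a module over `𝒜_1`. -/
structure IsActionTriple (h g T : Module.End k N) : Prop where
  h_h : ∀ n, h (h n) = n
  g_g : ∀ n, g (g n) = n
  braid : ∀ n, g (h (g n)) = h (g (h n))
  h_T : ∀ n, h (T n) = -T (h n)
  T_T : ∀ n, T (T n) = 0
  quad : ∀ n, T (h (g (T (g (h n))))) + g (h (T (h (g (T n)))))
    + h (g (T (g (h (g (h (T (h (g n))))))))) = n - h (g n)

/-- `x` spans a copy of the trivial representation (or is zero). -/
def IsTriv (h g : Module.End k N) (x : N) : Prop := h x = x ∧ g x = x

/-- `y` spans a copy of the sign representation (or is zero). -/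
def IsSgn (h g : Module.End k N) (y : N) : Prop := h y = -y ∧ g y = -y

/-- `v` is the first vector of a canonical basis `v, h v` of a copy of the standard
representation (or is zero). -/
def IsStd (h g : Module.End k N) (v : N) : Prop := g v = v - h v ∧ g (h v) = -h v

/-- The projection onto the isotypic component of the trivial representation. -/
def projTriv (h g : Module.End k N) : Module.End k N :=
  (1 / 6 : k) • (1 + h + g + h * g + g * h + h * g * h)

/-- The projection onto the isotypic component of the sign representation. -/
def projSgn (h g : Module.End k N) : Module.End k N :=
  (1 / 6 : k) • (1 - h - g + h * g + g * h - h * g * h)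

/-- The projection onto the first vectors in the isotypic component of the standard
representation. -/
def projStd (h g : Module.End k N) : Module.End k N :=
  (1 / 3 : k) • (1 + g - h * g * h - g * h)

namespace IsActionTriple

variable {h g T : Module.End k N}

theorem projTriv_isTriv (H : IsActionTriple h g T) (n : N) : IsTriv h g (projTriv h g n) := by
  constructor <;>
  · simp [projTriv, H.h_h, H.g_g, H.braid]
    module

theorem projSgn_isSgn (H : IsActionTriple h g T) (n : N) : IsSgn h g (projSgn h g n) := by
  constructor <;>
  · simp [projSgn, H.h_h, H.g_g, H.braid]
    module

theorem projStd_isStd (H : IsActionTriple h g T) (n : N) : IsStd h g (projStd h g n) := by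
  constructor <;>
  · simp [projStd, H.h_h, H.g_g, H.braid]
    module

variable [CharZero k]

/-- The two coordinates of the standard component are both stored as first vectors: p directly, and
q through h, which swaps the canonical basis. -/
theorem sum_proj (H : IsActionTriple h g T) (n : N) :
    n = projTriv h g n + projSgn h g n + projStd h g n + h (projStd h g (h n)) := by
  simp [projTriv, projSgn, projStd, H.h_h]
  module

theorem projTriv_eq (H : IsActionTriple h g T) {x y p q : N} (hx : IsTriv h g x)
    (hy : IsSgn h g y) (hp : IsStd h g p) (hq : IsStd h g q) : projTriv h g (x + y + p + h q) = x := by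
  simp [projTriv, hx.1, hx.2, hy.1, hy.2, hp.1, hp.2, hq.1, hq.2, H.h_h]
  module

theorem projSgn_eq (H : IsActionTriple h g T) {x y p q : N} (hx : IsTriv h g x)
    (hy : IsSgn h g y) (hp : IsStd h g p) (hq : IsStd h g q) : projSgn h g (x + y + p + h q) = y := by
  simp [projSgn, hx.1, hx.2, hy.1, hy.2, hp.1, hp.2, hq.1, hq.2, H.h_h]
  module

theorem projStd_eq (H : IsActionTriple h g T) {x y p q : N} (hx : IsTriv h g x)
    (hy : IsSgn h g y) (hp : IsStd h g p) (hq : IsStd h g q) : projStd h g (x + y + p + h q) = p := by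
  simp [projStd, hx.1, hx.2, hy.1, hy.2, hp.1, hp.2, hq.1, hq.2, H.h_h]
  module

theorem eq_zero_of_sum (H : IsActionTriple h g T) {x y p q : N} (hx : IsTriv h g x)
    (hy : IsSgn h g y) (hp : IsStd h g p) (hq : IsStd h g q) (hs : x + y + p + h q = 0) : x = 0 ∧ y = 0 ∧ p = 0 ∧ q = 0 := by
  have e1 := H.projTriv_eq hx hy hp hq
  have e2 := H.projSgn_eq hx hy hp hq
  have e3 := H.projStd_eq hx hy hp hq
  rw [hs, map_zero] at e1 e2 e3
  refine ⟨e1.symm, e2.symm, e3.symm, ?_⟩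
  rw [← e1, ← e2, ← e3] at hs
  rw [← H.h_h q, show h q = 0 by simpa using hs, map_zero]

end IsActionTriple

end Isotypic

/-! ### The blocks of $a_{12}$ between multiplicity spaces and their relations -/

section Blocks

variable {k N : Type*} [Field k] [AddCommGroup N] [Module k N]

/-- The trivial component of `T n`. -/
def trivPart (h g T : Module.End k N) : Module.End k N := projTriv h g * T

/-- The sign component of `T n`. -/
def sgnPart (h g T : Module.End k N) : Module.End k N := projSgn h g * T

/-- The first coordinate of the standard component of `T n`. -/
def fstPart (h g T : Module.End k N) : Module.End k N := projStd h g * T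

/-- The second coordinate of the standard component of `T n`. -/
def sndPart (h g T : Module.End k N) : Module.End k N := projStd h g * h * T

variable {h g T : Module.End k N}

theorem IsSgn.smul {x : N} (r : k) (hx : IsSgn h g x) : IsSgn h g (r • x) := by
  simp [IsSgn, hx.1, hx.2]

theorem IsStd.add {x y : N} (hx : IsStd h g x) (hy : IsStd h g y) : IsStd h g (x + y) := by
  constructor
  · simp only [map_add, hx.1, hy.1]; module
  · simp only [map_add, hx.2, hy.2]; module

theorem IsStd.smul {x : N} (r : k) (hx : IsStd h g x) : IsStd h g (r • x) := by
  constructor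
  · simp only [map_smul, hx.1]; module
  · simp only [map_smul, hx.2]; module

theorem isTriv_zero : IsTriv h g (0 : N) := by simp [IsTriv]

theorem isSgn_zero : IsSgn h g (0 : N) := by simp [IsSgn]

namespace IsActionTriple

theorem trivPart_isTriv (H : IsActionTriple h g T) (n : N) : IsTriv h g (trivPart h g T n) :=
  H.projTriv_isTriv _

theorem sgnPart_isSgn (H : IsActionTriple h g T) (n : N) : IsSgn h g (sgnPart h g T n) :=
  H.projSgn_isSgn _

theorem fstPart_isStd (H : IsActionTriple h g T) (n : N) : IsStd h g (fstPart h g T n) :=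
  H.projStd_isStd _

theorem sndPart_isStd (H : IsActionTriple h g T) (n : N) : IsStd h g (sndPart h g T n) :=
  H.projStd_isStd _

/-- Since T anticommutes with h, its values on h n carry no new information: they are those on n
with the coordinates exchanged and negated. -/
theorem fstPart_h (H : IsActionTriple h g T) (n : N) :
    fstPart h g T (h n) = -sndPart h g T n := by
  have e : T (h n) = -h (T n) := by rw [H.h_T, neg_neg]
  simp only [fstPart, sndPart, Module.End.mul_apply, e, map_neg]

theorem sndPart_h (H : IsActionTriple h g T) (n : N) :
    sndPart h g T (h n) = -fstPart h g T n := by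
  rw [← H.h_h n, H.fstPart_h, neg_neg, H.h_h]

theorem sndPart_of_isTriv (H : IsActionTriple h g T) {x : N} (hx : IsTriv h g x) :
    sndPart h g T x = -fstPart h g T x := by
  rw [← H.sndPart_h, hx.1]

theorem sndPart_of_isSgn (H : IsActionTriple h g T) {y : N} (hy : IsSgn h g y) :
    sndPart h g T y = fstPart h g T y := by
  rw [← neg_inj, ← H.sndPart_h, hy.1, map_neg]

variable [CharZero k]

theorem T_apply (H : IsActionTriple h g T) (n : N) : T n =
    trivPart h g T n + sgnPart h g T n + fstPart h g T n + h (sndPart h g T n) :=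
  H.sum_proj _

theorem trivPart_h (H : IsActionTriple h g T) (n : N) :
    trivPart h g T (h n) = -trivPart h g T n := by
  have e : T (h n) = -h (T n) := by rw [H.h_T, neg_neg]
  simp only [trivPart, projTriv, Module.End.mul_apply, LinearMap.smul_apply, LinearMap.add_apply,
    Module.End.one_apply, e, map_neg, H.h_h]
  module

theorem sgnPart_h (H : IsActionTriple h g T) (n : N) :
    sgnPart h g T (h n) = sgnPart h g T n := by
  have e : T (h n) = -h (T n) := by rw [H.h_T, neg_neg]
  simp only [sgnPart, projSgn, Module.End.mul_apply, LinearMap.smul_apply, LinearMap.add_apply,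
    LinearMap.sub_apply, Module.End.one_apply, e, map_neg, H.h_h]
  module

theorem trivPart_of_isTriv (H : IsActionTriple h g T) {x : N} (hx : IsTriv h g x) :
    trivPart h g T x = 0 := by
  have e := H.trivPart_h x
  rw [hx.1] at e
  linear_combination (norm := module) (1 / 2 : k) • e

theorem sgnPart_of_isSgn (H : IsActionTriple h g T) {y : N} (hy : IsSgn h g y) :
    sgnPart h g T y = 0 := by
  have e := H.sgnPart_h y
  rw [hy.1, map_neg] at e
  linear_combination (norm := module) (-1 / 2 : k) • e

theorem sq_of_isTriv (H : IsActionTriple h g T) {x : N} (hx : IsTriv h g x) :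
    trivPart h g T (sgnPart h g T x) + (2 : k) • trivPart h g T (fstPart h g T x) = 0 := by
  have e := congr_arg (projTriv h g) (H.T_T x)
  rw [map_zero] at e
  change trivPart h g T (T x) = 0 at e
  rw [H.T_apply x, H.trivPart_of_isTriv hx, H.sndPart_of_isTriv hx] at e
  simp only [map_add, map_neg, map_zero, H.trivPart_h] at e
  linear_combination (norm := module) e

/-- These are the trivial, sign, first and second standard coordinates of T² v = 0. -/
theorem sq_std (H : IsActionTriple h g T) (v : N) :
    trivPart h g T (sgnPart h g T v)
      + trivPart h g T (fstPart h g T v - sndPart h g T v) = 0 ∧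
    sgnPart h g T (trivPart h g T v)
      + sgnPart h g T (fstPart h g T v + sndPart h g T v) = 0 ∧
    fstPart h g T (trivPart h g T v) + fstPart h g T (sgnPart h g T v)
      + fstPart h g T (fstPart h g T v) - sndPart h g T (sndPart h g T v) = 0 ∧
    -fstPart h g T (trivPart h g T v) + fstPart h g T (sgnPart h g T v)
      + sndPart h g T (fstPart h g T v) - fstPart h g T (sndPart h g T v) = 0 := by
  have e := H.T_T v
  have e1 : trivPart h g T (T v) = 0 := (congr_arg (projTriv h g) e).trans (map_zero _)
  have e2 : sgnPart h g T (T v) = 0 := (congr_arg (projSgn h g) e).trans (map_zero _)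
  have e3 : fstPart h g T (T v) = 0 := (congr_arg (projStd h g) e).trans (map_zero _)
  have e4 : sndPart h g T (T v) = 0 := (congr_arg (projStd h g * h) e).trans (map_zero _)
  rw [H.T_apply v] at e1 e2 e3 e4
  simp only [map_add, H.trivPart_h, H.sgnPart_h, H.fstPart_h, H.sndPart_h,
    H.trivPart_of_isTriv (H.trivPart_isTriv _), H.sgnPart_of_isSgn (H.sgnPart_isSgn _),
    H.sndPart_of_isTriv (H.trivPart_isTriv _), H.sndPart_of_isSgn (H.sgnPart_isSgn _)]
    at e1 e2 e3 e4
  simp only [map_add, map_sub]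
  refine ⟨?_, ?_, ?_, ?_⟩
  · linear_combination (norm := module) e1
  · linear_combination (norm := module) e2
  · linear_combination (norm := module) e3
  · linear_combination (norm := module) e4

/-- The rotations 1, gh, hg act trivially on both one-dimensional types, so averaging over them
already determines the trivial and sign components. -/
theorem proj_of_rotation_sum (H : IsActionTriple h g T) {m : N}
    (hm : m + g (h m) + h (g m) = 0) : projTriv h g m = 0 ∧ projSgn h g m = 0 := by
  have hm' : h m + h (g (h m)) + g m = 0 := by
    simpa [H.h_h] using congr_arg h hm
  constructor
  · simp only [projTriv, Module.End.mul_apply, LinearMap.smul_apply, LinearMap.add_apply,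
      Module.End.one_apply]
    linear_combination (norm := module) (1 / 6 : k) • hm + (1 / 6 : k) • hm'
  · simp only [projSgn, Module.End.mul_apply, LinearMap.smul_apply, LinearMap.add_apply,
      LinearMap.sub_apply, Module.End.one_apply]
    linear_combination (norm := module) (1 / 6 : k) • hm - (1 / 6 : k) • hm'

/-- On a trivial vector the right side of the quadratic relation vanishes and the left side is the
sum of the three rotations of T(hg(Tx)), whose trivial and sign components therefore vanish. This is
the source of the nilpotency of CD. -/
theorem fstPart_of_isTriv (H : IsActionTriple h g T) {x : N} (hx : IsTriv h g x) :
    trivPart h g T (fstPart h g T x) = 0 ∧ sgnPart h g T (fstPart h g T x) = 0 := by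
  have e := H.quad x
  have hp := H.fstPart_isStd x
  have hs := H.sgnPart_isSgn x
  have hz : h (g (T x)) = sgnPart h g T x + h (fstPart h g T x) := by
    rw [H.T_apply x, H.trivPart_of_isTriv hx, H.sndPart_of_isTriv hx]
    simp only [map_add, map_neg, map_zero, map_sub, hp.1, hp.2, hs.1, hs.2, H.h_h]
    module
  have hr : ∀ n, g (h (g (h n))) = h (g n) := fun n => by rw [← H.braid, H.g_g]
  rw [hx.1, hx.2, hx.1, hr, hz, sub_self] at e
  obtain ⟨e1, e2⟩ := H.proj_of_rotation_sum e
  change trivPart h g T _ = 0 at e1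
  change sgnPart h g T _ = 0 at e2
  rw [map_add, H.trivPart_h] at e1
  rw [map_add, H.sgnPart_h, H.sgnPart_of_isSgn hs, zero_add] at e2
  refine ⟨?_, e2⟩
  -- The trivial part of T applied to the sign part of Tx occurs in both relations; subtracting
  -- leaves three times the desired term.
  linear_combination (norm := module) (1 / 3 : k) • (H.sq_of_isTriv hx - e1)

/-- Comparing the two standard coordinates in the quadratic relation, after every block has been
moved into normal form, gives these identities. -/
theorem quad_std (H : IsActionTriple h g T) {v : N} (hv : IsStd h g v) :
    (5 : k) • fstPart h g T (fstPart h g T v) + (4 : k) • fstPart h g T (sndPart h g T v)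
      + (4 : k) • sndPart h g T (fstPart h g T v) + (5 : k) • sndPart h g T (sndPart h g T v)
      + (2 : k) • v = 0 ∧
    (-2 : k) • fstPart h g T (trivPart h g T v) + (-2 : k) • fstPart h g T (sgnPart h g T v)
      + fstPart h g T (fstPart h g T v) - sndPart h g T (sndPart h g T v) = 0 := by
  have e := H.quad v
  have hr : ∀ n, g (h (g (h n))) = h (g n) := fun n => by rw [← H.braid, H.g_g]
  have t1 : ∀ n, g (trivPart h g T n) = trivPart h g T n := fun n => (H.trivPart_isTriv n).2
  have t2 : ∀ n, h (trivPart h g T n) = trivPart h g T n := fun n => (H.trivPart_isTriv n).1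
  have s1 : ∀ n, g (sgnPart h g T n) = -sgnPart h g T n := fun n => (H.sgnPart_isSgn n).2
  have s2 : ∀ n, h (sgnPart h g T n) = -sgnPart h g T n := fun n => (H.sgnPart_isSgn n).1
  have p1 : ∀ n, g (fstPart h g T n) = fstPart h g T n - h (fstPart h g T n) :=
    fun n => (H.fstPart_isStd n).1
  have p2 : ∀ n, g (h (fstPart h g T n)) = - h (fstPart h g T n) :=
    fun n => (H.fstPart_isStd n).2
  have q1 : ∀ n, g (sndPart h g T n) = sndPart h g T n - h (sndPart h g T n) :=
    fun n => (H.sndPart_isStd n).1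
  have q2 : ∀ n, g (h (sndPart h g T n)) = - h (sndPart h g T n) :=
    fun n => (H.sndPart_isStd n).2
  rw [hr] at e
  simp only [hv.1, hv.2, map_add, map_sub, map_neg, map_zero, H.h_h, H.T_apply, H.trivPart_h,
    H.sgnPart_h, H.fstPart_h, H.sndPart_h,
    H.trivPart_of_isTriv (H.trivPart_isTriv _), H.sgnPart_of_isSgn (H.sgnPart_isSgn _),
    H.sndPart_of_isTriv (H.trivPart_isTriv _), H.sndPart_of_isSgn (H.sgnPart_isSgn _),
    t1, t2, s1, s2, p1, p2, q1, q2] at e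
  have hfst := fun n => H.fstPart_isStd n
  have hsnd := fun n => H.sndPart_isStd n
  have hP : IsStd h g ((5 : k) • fstPart h g T (fstPart h g T v)
      + (4 : k) • fstPart h g T (sndPart h g T v)
      + (4 : k) • sndPart h g T (fstPart h g T v) + (5 : k) • sndPart h g T (sndPart h g T v)
      + (2 : k) • v) :=
    (((((hfst _).smul _).add ((hfst _).smul _)).add ((hsnd _).smul _)).add
      ((hsnd _).smul _)).add (hv.smul _)
  have hQ : IsStd h g ((-2 : k) • fstPart h g T (trivPart h g T v)
      + (-2 : k) • fstPart h g T (sgnPart h g T v)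
      + fstPart h g T (fstPart h g T v) + (-1 : k) • sndPart h g T (sndPart h g T v)) :=
    ((((hfst _).smul _).add ((hfst _).smul _)).add (hfst _)).add ((hsnd _).smul _)
  -- If P and Q are the left sides of the two identities, the relation reads -P + h(P/2 + 3Q/2) = 0,
  -- and the coordinates are independent.
  have key := H.eq_zero_of_sum isTriv_zero isSgn_zero (hP.smul (-1 : k))
    ((hP.smul (1 / 2 : k)).add (hQ.smul (3 / 2 : k))) (by
      simp only [map_add, map_smul]
      linear_combination (norm := module) e)
  have kP := key.2.2.1
  refine ⟨by linear_combination (norm := module) -kP, ?_⟩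
  linear_combination (norm := module) (2 / 3 : k) • key.2.2.2 + (1 / 3 : k) • kP

end IsActionTriple

end Blocks

/-! ### The operators C = c + d and D = c - d, and the eigenvalue 2i of D -/

section Eigenvector

variable {k N : Type*} [Field k] [AddCommGroup N] [Module k N] {h g T : Module.End k N}

/-- The operator `c + d` on the multiplicity space of the standard representation. -/
def sumPart (h g T : Module.End k N) : Module.End k N := fstPart h g T + sndPart h g T

/-- The operator `c - d` on the multiplicity space of the standard representation. -/
def diffPart (h g T : Module.End k N) : Module.End k N := fstPart h g T - sndPart h g T

/-- The projection to the eigenspace of `c - d` for the eigenvalue `2 i`. -/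
def eigenProj (h g T : Module.End k N) (I : k) : Module.End k N :=
  (I / 16) • (diffPart h g T ^ 3 + (2 * I) • diffPart h g T ^ 2)

namespace IsActionTriple

theorem sumPart_isStd (H : IsActionTriple h g T) (n : N) : IsStd h g (sumPart h g T n) :=
  (H.fstPart_isStd n).add (H.sndPart_isStd n)

theorem diffPart_isStd (H : IsActionTriple h g T) (n : N) : IsStd h g (diffPart h g T n) := by
  have e := (H.fstPart_isStd n).add ((H.sndPart_isStd n).smul (-1 : k))
  rwa [neg_one_smul, ← sub_eq_add_neg] at e

theorem eigenProj_isStd (H : IsActionTriple h g T) (I : k) (n : N) :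
    IsStd h g (eigenProj h g T I n) := by
  have e := ((H.diffPart_isStd (diffPart h g T (diffPart h g T n))).add
    ((H.diffPart_isStd (diffPart h g T n)).smul (2 * I))).smul (I / 16)
  simpa [eigenProj, pow_succ] using e

variable [CharZero k]

/-- Anticommutation amounts to c² = d². The relations from T² = 0 and from the quadratic relation
contain c² - d² with different multiples of the same remaining terms, so these cancel. -/
theorem diffPart_sumPart (H : IsActionTriple h g T) {v : N} (hv : IsStd h g v) :
    diffPart h g T (sumPart h g T v) = -sumPart h g T (diffPart h g T v) := by
  obtain ⟨-, -, e3, -⟩ := H.sq_std v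
  obtain ⟨-, f⟩ := H.quad_std hv
  simp only [sumPart, diffPart, LinearMap.add_apply, LinearMap.sub_apply, map_add, map_sub]
  linear_combination (norm := module) (2 / 3 : k) • f + (4 / 3 : k) • e3

theorem sumPart_sumPart (H : IsActionTriple h g T) {v : N} (hv : IsStd h g v) :
    (9 : k) • sumPart h g T (sumPart h g T v) = -(4 : k) • v
      - diffPart h g T (diffPart h g T v) := by
  obtain ⟨f, -⟩ := H.quad_std hv
  simp only [sumPart, diffPart, LinearMap.add_apply, LinearMap.sub_apply, map_add, map_sub]
  linear_combination (norm := module) (2 : k) • f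

theorem fstPart_trivPart (H : IsActionTriple h g T) {v : N} (hv : IsStd h g v) :
    fstPart h g T (trivPart h g T v) = (1 / 2 : k) • sumPart h g T (diffPart h g T v) := by
  obtain ⟨-, -, e3, e4⟩ := H.sq_std v
  obtain ⟨-, f⟩ := H.quad_std hv
  simp only [sumPart, diffPart, LinearMap.add_apply, LinearMap.sub_apply, map_sub]
  linear_combination (norm := module) (-1 / 2 : k) • e4 - (1 / 3 : k) • f - (1 / 6 : k) • e3

theorem fstPart_sgnPart (H : IsActionTriple h g T) {v : N} (hv : IsStd h g v) :
    fstPart h g T (sgnPart h g T v) = (-1 / 2 : k) • sumPart h g T (diffPart h g T v) := by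
  obtain ⟨-, -, e3, e4⟩ := H.sq_std v
  obtain ⟨-, f⟩ := H.quad_std hv
  have e := H.fstPart_trivPart hv
  simp only [sumPart, diffPart, LinearMap.add_apply, LinearMap.sub_apply, map_sub] at e ⊢
  linear_combination (norm := module) (1 / 3 : k) • (e3 - f) - e

/-- CDv is twice the first coordinate of T on a trivial vector, and such a first vector has no
trivial part under T; applying CD again therefore gives zero. -/
theorem sumPart_diffPart_sq (H : IsActionTriple h g T) {v : N} (hv : IsStd h g v) :
    sumPart h g T (diffPart h g T (sumPart h g T (diffPart h g T v))) = 0 := by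
  have e := H.fstPart_trivPart (H.sumPart_isStd (diffPart h g T v))
  have f : sumPart h g T (diffPart h g T v) = (2 : k) • fstPart h g T (trivPart h g T v) := by
    rw [H.fstPart_trivPart hv]
    module
  have f' : trivPart h g T (sumPart h g T (diffPart h g T v)) = 0 := by
    rw [f, map_smul, (H.fstPart_of_isTriv (H.trivPart_isTriv v)).1, smul_zero]
  rw [f', map_zero] at e
  linear_combination (norm := module) (-2 : k) • e

/-- Apply D² to 9C² = -4 - D²: by anticommutation D²C² is (CD)² up to sign, hence zero. -/
theorem diffPart_pow_four (H : IsActionTriple h g T) {v : N} (hv : IsStd h g v) :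
    diffPart h g T (diffPart h g T (diffPart h g T (diffPart h g T v)))
      = -(4 : k) • diffPart h g T (diffPart h g T v) := by
  have e := congr_arg (fun n => diffPart h g T (diffPart h g T n)) (H.sumPart_sumPart hv)
  have z : diffPart h g T (diffPart h g T (sumPart h g T (sumPart h g T v))) = 0 := by
    rw [H.diffPart_sumPart (H.sumPart_isStd v), H.diffPart_sumPart hv, map_neg, map_neg, map_neg,
      neg_neg, H.diffPart_sumPart (H.sumPart_isStd _), H.sumPart_diffPart_sq hv, neg_zero]
  simp only [map_smul, map_sub, z] at e
  linear_combination (norm := module) e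

/-- A vector of type `v` that is an eigenvector of `c - d` for the eigenvalue `2 i` satisfies
the defining relations of the module `P`. -/
theorem exists_of_eigenvector (H : IsActionTriple h g T) (I : k) (hI : I ^ 2 = -1) {v : N}
    (hv : IsStd h g v) (hD : diffPart h g T v = (2 * I) • v) :
    ∃ x y u : N, IsTriv h g x ∧ IsSgn h g y ∧ IsStd h g u ∧
      T x = (2 * I) • u - (2 * I) • h u ∧ T y = x + u + h u ∧ T u = -I • u + I • h u ∧
      T v = x - (2 * I) • y + u + h u + I • v - I • h v := by
  have hC : sumPart h g T (diffPart h g T v) = (2 * I) • sumPart h g T v := by rw [hD, map_smul]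
  set u := (1 / 2 : k) • sumPart h g T v with hu
  have hus : IsStd h g u := (H.sumPart_isStd v).smul _
  have hCv : sumPart h g T v = (2 : k) • u := by rw [hu]; module
  have hpt : fstPart h g T (trivPart h g T v) = (2 * I) • u := by
    rw [H.fstPart_trivPart hv, hC, hCv]; module
  have hps : fstPart h g T (sgnPart h g T v) = (-2 * I) • u := by
    rw [H.fstPart_sgnPart hv, hC, hCv]; module
  -- Expressing u as a first coordinate of T on a trivial vector is what kills the trivial and sign
  -- parts of Tu.
  have hu' : u = (-I / 2) • fstPart h g T (trivPart h g T v) := by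
    rw [hpt, smul_smul, show -I / 2 * (2 * I) = 1 by linear_combination -hI, one_smul]
  obtain ⟨tu, su⟩ : trivPart h g T u = 0 ∧ sgnPart h g T u = 0 := by
    rw [hu', map_smul, map_smul]
    obtain ⟨e1, e2⟩ := H.fstPart_of_isTriv (H.trivPart_isTriv v)
    rw [e1, e2, smul_zero]
    exact ⟨rfl, rfl⟩
  obtain ⟨e1, e2, -, -⟩ := H.sq_std v
  change _ + trivPart h g T (diffPart h g T v) = 0 at e1
  change _ + sgnPart h g T (sumPart h g T v) = 0 at e2
  rw [hD, map_smul] at e1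
  rw [hCv, map_smul, su, smul_zero, add_zero] at e2
  have hDu : fstPart h g T u - sndPart h g T u = -(2 * I) • u := by
    change diffPart h g T u = _
    rw [hu, map_smul, H.diffPart_sumPart hv, hC]
    module
  -- On the eigenspace D² = -4, so 9C² = -4 - D² vanishes there.
  have hCu : fstPart h g T u + sndPart h g T u = 0 := by
    change sumPart h g T u = _
    have e := H.sumPart_sumPart hv
    rw [hD, map_smul, hD, smul_smul, show 2 * I * (2 * I) = -4 by linear_combination 4 * hI,
      hCv, map_smul] at e
    linear_combination (norm := module) (1 / 18 : k) • e
  have hDv : fstPart h g T v - sndPart h g T v = (2 * I) • v := hD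
  have hCv' : fstPart h g T v + sndPart h g T v = (2 : k) • u := hCv
  have pu : fstPart h g T u = -I • u := by
    linear_combination (norm := module) (1 / 2 : k) • (hDu + hCu)
  have qu : sndPart h g T u = I • u := by
    linear_combination (norm := module) (1 / 2 : k) • (hCu - hDu)
  have pv : fstPart h g T v = u + I • v := by
    linear_combination (norm := module) (1 / 2 : k) • (hDv + hCv')
  have qv : sndPart h g T v = u - I • v := by
    linear_combination (norm := module) (1 / 2 : k) • (hCv' - hDv)
  clear_value u
  -- The factor i/2 makes the sign part of Tv equal to -2i y, as the table of P demands.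
  refine ⟨trivPart h g T v, (I / 2) • sgnPart h g T v, u, H.trivPart_isTriv v,
    (H.sgnPart_isSgn v).smul _, hus, ?_, ?_, ?_, ?_⟩
  · rw [H.T_apply, H.sndPart_of_isTriv (H.trivPart_isTriv v), H.trivPart_of_isTriv
      (H.trivPart_isTriv v), e2, hpt, map_neg, map_smul]
    module
  · have e1' : trivPart h g T (sgnPart h g T v) = -(2 * I) • trivPart h g T v := by
      linear_combination (norm := module) e1
    rw [map_smul, H.T_apply, H.sndPart_of_isSgn (H.sgnPart_isSgn v), H.sgnPart_of_isSgn
      (H.sgnPart_isSgn v), hps, e1', map_smul]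
    have e : I / 2 * (-2 * I) = 1 := by linear_combination -hI
    have e' : I / 2 * -(2 * I) = 1 := by linear_combination -hI
    simp only [smul_add, smul_smul, e, e', smul_zero]
    module
  · rw [H.T_apply, tu, su, pu, qu, map_smul]
    module
  · rw [H.T_apply v, pv, qv, smul_smul, show 2 * I * (I / 2) = -1 by linear_combination hI,
      map_sub, map_smul]
    module

/-- By D⁴ = -4D², the polynomial D²(D - 2i)(D + 2i) annihilates first vectors. The projection is
D²(D + 2i), scaled by i/16 so that it takes the value 1 at 2i. -/
theorem diffPart_eigenProj (H : IsActionTriple h g T) (I : k) (hI : I ^ 2 = -1) {n : N}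
    (hn : IsStd h g n) :
    diffPart h g T (eigenProj h g T I n) = (2 * I) • eigenProj h g T I n := by
  have e := H.diffPart_pow_four hn
  simp only [eigenProj, pow_succ, pow_zero, one_mul, LinearMap.smul_apply, LinearMap.add_apply,
    Module.End.mul_apply, map_smul, map_add, e]
  match_scalars
  · linear_combination (-1 / 4) * I * hI
  · ring

end IsActionTriple

end Eigenvector

/-! ### Generators of the algebra, and modules as triples of operators -/

section Generation

variable {k : Type*} [Field k]

theorem Alg.a_eq_conj12 (l : k) (i : Transp) :
    Alg.a l i = conj12 (Alg.Hhom l) (Alg.a l s12) i := by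
  have e1 : ∀ i : S3, i.IsSwap → Equiv.Perm.sign (s12.1 * i) = 1 ∧
      s12.1 * i * s12.1 * (s12.1 * i)⁻¹ = i ∧ (s12.1 * i) * (i * s12.1) = 1 := by decide
  obtain ⟨f1, f2, f3⟩ := e1 i.1 i.2
  have f1' : sg k (s12.1 * i.1) = 1 := by simp [sg, f1]
  have f2' : conj (s12.1 * i.1) s12 = i := Subtype.ext f2
  change _ = Alg.H l (s12.1 * i.1) * Alg.a l s12 * Alg.H l (i.1 * s12.1)
  rw [Alg.H_a, f1', f2', one_smul, mul_assoc, Alg.H_mul, f3, Alg.H_one, mul_one]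

theorem s3_cases : ∀ t : S3, t = 1 ∨ t = s12.1 ∨ t = s23.1 ∨ t = s12.1 * s23.1 ∨
    t = s23.1 * s12.1 ∨ t = s12.1 * s23.1 * s12.1 := by decide

theorem Alg.adjoin_range (l : k) :
    Algebra.adjoin k (Set.range (Alg.H l) ∪ Set.range (Alg.a l)) = ⊤ := by
  have e : (⊤ : Subalgebra k (FreeAlgebra k Gen)).map (Alg.mk l) = ⊤ := by
    rw [Algebra.map_top, AlgHom.range_eq_top]
    exact RingQuot.mkAlgHom_surjective k (Rel l)
  rw [← FreeAlgebra.adjoin_range_ι, AlgHom.map_adjoin] at e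
  rw [← e]
  congr 1
  ext z
  constructor
  · rintro (⟨t, rfl⟩ | ⟨i, rfl⟩)
    · exact ⟨_, ⟨Gen.H t, rfl⟩, rfl⟩
    · exact ⟨_, ⟨Gen.a i, rfl⟩, rfl⟩
  · rintro ⟨_, ⟨g | g, rfl⟩, rfl⟩
    · exact Or.inl ⟨g, rfl⟩
    · exact Or.inr ⟨g, rfl⟩

/-- Two transpositions generate the group, and every $a_\sigma$ is a conjugate of $a_{12}$ by an
even permutation. -/
theorem Alg.adjoin_eq_top (l : k) :
    Algebra.adjoin k {Alg.H l s12.1, Alg.H l s23.1, Alg.a l s12} = ⊤ := by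
  set S := Algebra.adjoin k {Alg.H l s12.1, Alg.H l s23.1, Alg.a l s12}
  have h1 : Alg.H l s12.1 ∈ S := Algebra.subset_adjoin (by simp)
  have h2 : Alg.H l s23.1 ∈ S := Algebra.subset_adjoin (by simp)
  have h3 : Alg.a l s12 ∈ S := Algebra.subset_adjoin (by simp)
  have hH : ∀ t, Alg.H l t ∈ S := by
    intro t
    rcases s3_cases t with rfl | rfl | rfl | rfl | rfl | rfl
    · rw [Alg.H_one]; exact S.one_mem
    · exact h1
    · exact h2
    · rw [← Alg.H_mul]; exact S.mul_mem h1 h2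
    · rw [← Alg.H_mul]; exact S.mul_mem h2 h1
    · rw [← Alg.H_mul, ← Alg.H_mul]; exact S.mul_mem (S.mul_mem h1 h2) h1
  rw [eq_top_iff, ← Alg.adjoin_range l, Algebra.adjoin_le_iff]
  rintro _ (⟨t, rfl⟩ | ⟨i, rfl⟩)
  · exact hH t
  · rw [Alg.a_eq_conj12]
    exact S.mul_mem (S.mul_mem (hH _) h3) (hH _)

/-- A linear map between two representations is a homomorphism if it commutes with `H_{12}`,
`H_{23}` and `a_{12}`. -/
theorem Alg.intertwines {l : k} {V W : Type*} [AddCommGroup V] [Module k V] [AddCommGroup W]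
    [Module k W] {ρ : Alg l →ₐ[k] Module.End k V} {σ : Alg l →ₐ[k] Module.End k W}
    (s : V →ₗ[k] W)
    (h1 : ∀ v, s (ρ (Alg.H l s12.1) v) = σ (Alg.H l s12.1) (s v))
    (h2 : ∀ v, s (ρ (Alg.H l s23.1) v) = σ (Alg.H l s23.1) (s v))
    (h3 : ∀ v, s (ρ (Alg.a l s12) v) = σ (Alg.a l s12) (s v)) (z : Alg l) (v : V) :
    s (ρ z v) = σ z (s v) := by
  have hz : z ∈ Algebra.adjoin k {Alg.H l s12.1, Alg.H l s23.1, Alg.a l s12} := by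
    rw [Alg.adjoin_eq_top]; trivial
  induction hz using Algebra.adjoin_induction generalizing v with
  | mem z hz =>
    rcases hz with rfl | rfl | rfl
    · exact h1 v
    · exact h2 v
    · exact h3 v
  | algebraMap r => simp [Module.algebraMap_end_apply]
  | add y z _ _ hy hz => simp [hy, hz]
  | mul y z _ _ hy hz => simp [hy, hz]

theorem isActionTriple {N : Type*} [AddCommGroup N] [Module k N]
    (σ : Alg (1 : k) →ₐ[k] Module.End k N) :
    IsActionTriple (σ (Alg.H 1 s12.1)) (σ (Alg.H 1 s23.1)) (σ (Alg.a 1 s12)) := by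
  have hmul : ∀ (y z : Alg (1 : k)) n, σ y (σ z n) = σ (y * z) n := by simp
  have hs : s12.1 * s12.1 = 1 ∧ s23.1 * s23.1 = 1 ∧
    s23.1 * (s12.1 * s23.1) = s12.1 * (s23.1 * s12.1) ∧ s12 ≠ s23 ∧ conj s12.1 s23 = s13 ∧
    s12.1 * s13.1 = s23.1 * s12.1 ∧ s13.1 * s12.1 = s12.1 * s23.1 := by decide
  obtain ⟨f1, f2, f3, f4, f5, f6, f7⟩ := hs
  refine ⟨fun n => ?_, fun n => ?_, fun n => ?_, fun n => ?_, fun n => ?_, fun n => ?_⟩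
  · rw [hmul, Alg.H_mul, f1, Alg.H_one, map_one, Module.End.one_apply]
  · rw [hmul, Alg.H_mul, f2, Alg.H_one, map_one, Module.End.one_apply]
  · simp only [hmul, Alg.H_mul, f3]
  · rw [hmul, Alg.H_a, sg_transp, conj_self, neg_one_smul, map_neg, LinearMap.neg_apply, hmul]
  · rw [hmul, Alg.a_sq, map_zero, LinearMap.zero_apply]
  · have e := congr_arg (fun z => σ z n) (Alg.a_quad (1 : k) s12 s23 f4)
    rw [f5, Alg.a_eq_conj12 1 s23, Alg.a_eq_conj12 1 s13] at e
    change σ (_ * (Alg.H 1 (s12.1 * s23.1) * _ * Alg.H 1 (s23.1 * s12.1)) +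
      (Alg.H 1 (s12.1 * s13.1) * _ * Alg.H 1 (s13.1 * s12.1)) * _ +
      (Alg.H 1 (s12.1 * s23.1) * _ * Alg.H 1 (s23.1 * s12.1)) *
      (Alg.H 1 (s12.1 * s13.1) * _ * Alg.H 1 (s13.1 * s12.1))) n = _ at e
    simpa [f6, f7, ← Alg.H_mul] using e

end Generation

/-! ### The module P: existence and uniqueness -/

section ModuleP

variable {k : Type*} [Field k]

/-- The matrix of `a_{12}` on `P` in the basis `x, y, u, t, v, w`. -/
def mat6 (I : k) : Matrix (Fin 6) (Fin 6) k :=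
  !![0, 1, 0, 0, 1, -1;
     0, 0, 0, 0, -2 * I, -2 * I;
     2 * I, 1, -I, -I, 1, -1;
     -2 * I, 1, I, I, 1, -1;
     0, 0, 0, 0, I, I;
     0, 0, 0, 0, -I, -I]

theorem grp6_apply (t : S3) : grp6 k t =
    !![1, 0, 0, 0, 0, 0;
       0, sg k t, 0, 0, 0, 0;
       0, 0, st k t 0 0, st k t 0 1, 0, 0;
       0, 0, st k t 1 0, st k t 1 1, 0, 0;
       0, 0, 0, 0, st k t 0 0, st k t 0 1;
       0, 0, 0, 0, st k t 1 0, st k t 1 1] := rfl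

theorem grp6_s12_s23 : grp6 k (s12.1 * s23.1) =
    !![1, 0, 0, 0, 0, 0; 0, 1, 0, 0, 0, 0; 0, 0, -1, -1, 0, 0; 0, 0, 1, 0, 0, 0;
       0, 0, 0, 0, -1, -1; 0, 0, 0, 0, 1, 0] := by
  rw [grp6_apply, map_mul, map_mul, st_s12, st_s23, sg_transp, sg_transp]
  simp

theorem grp6_s12_s13 : grp6 k (s12.1 * s13.1) =
    !![1, 0, 0, 0, 0, 0; 0, 1, 0, 0, 0, 0; 0, 0, 0, 1, 0, 0; 0, 0, -1, -1, 0, 0;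
       0, 0, 0, 0, 0, 1; 0, 0, 0, 0, -1, -1] := by
  rw [grp6_apply, map_mul, map_mul, st_s12, st_s13, sg_transp, sg_transp]
  simp

theorem mat6_comm (I : k) : grp6 k s12.1 * mat6 I = -(mat6 I * grp6 k s12.1) := by
  rw [grp6_apply, st_s12, sg_transp, mat6]
  simp

theorem mat6_sq (I : k) (hI : I ^ 2 = -1) : mat6 I * mat6 I = 0 := by
  have h : I * I = -1 := by rw [← sq, hI]
  rw [mat6]
  ext i j
  simp [h, mul_assoc]
  ring_nf
  fin_cases i <;> fin_cases j <;> rfl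

theorem mat6_s23 (I : k) : conj12 (grp6 k) (mat6 I) s23 =
    !![0, 1, 0, 0, 1, 2;
       0, 0, 0, 0, 2 * I, 0;
       0, -2, 0, 0, -2, -4;
       2 * I, 1, I, 0, 1, 2;
       0, 0, 0, 0, 0, 0;
       0, 0, 0, 0, -I, 0] := by
  have e : s23.1 * s12.1 = s12.1 * s13.1 := by decide
  rw [conj12, e, grp6_s12_s23, grp6_s12_s13, mat6]
  simp
  ring_nf
  refine ⟨trivial, ⟨trivial, trivial⟩, trivial, ?_⟩
  ext i; fin_cases i <;> rfl

theorem mat6_s13 (I : k) : conj12 (grp6 k) (mat6 I) s13 =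
    !![0, 1, 0, 0, -2, -1;
       0, 0, 0, 0, 0, 2 * I;
       -2 * I, 1, 0, -I, -2, -1;
       0, -2, 0, 0, 4, 2;
       0, 0, 0, 0, 0, I;
       0, 0, 0, 0, 0, 0] := by
  have e : s13.1 * s12.1 = s12.1 * s23.1 := by decide
  rw [conj12, e, grp6_s12_s23, grp6_s12_s13, mat6]
  simp
  ring_nf
  refine ⟨trivial, ⟨trivial, trivial, trivial⟩, ?_⟩
  ext i; fin_cases i <;> rfl

theorem one_fin_six : (1 : Matrix (Fin 6) (Fin 6) k) =
    !![1, 0, 0, 0, 0, 0; 0, 1, 0, 0, 0, 0; 0, 0, 1, 0, 0, 0; 0, 0, 0, 1, 0, 0;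
       0, 0, 0, 0, 1, 0; 0, 0, 0, 0, 0, 1] := by
  ext i j; fin_cases i <;> fin_cases j <;> rfl

theorem mat6_quad (I : k) (hI : I ^ 2 = -1) :
    mat6 I * conj12 (grp6 k) (mat6 I) s23 + conj12 (grp6 k) (mat6 I) s13 * mat6 I
      + conj12 (grp6 k) (mat6 I) s23 * conj12 (grp6 k) (mat6 I) s13
      = (1 : k) • (1 - grp6 k (s12.1 * s23.1)) := by
  have h : I * I = -1 := by rw [← sq, hI]
  rw [mat6_s23, mat6_s13, grp6_s12_s23, mat6, one_smul, one_fin_six]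
  simp [h, mul_assoc]
  ring_nf
  simp

/-- The representation of `𝒜_1` on `P`. -/
def repP (I : k) (hI : I ^ 2 = -1) : Alg (1 : k) →ₐ[k] Module.End k (Fin 6 → k) :=
  colRep (Alg.lift12 1 (grp6 k) (mat6 I) (mat6_comm I) (mat6_sq I hI) (mat6_quad I hI))

section lift12

variable {n : ℕ} (l : k) (σ : S3 →* Matrix (Fin n) (Fin n) k) (T : Matrix (Fin n) (Fin n) k)
    (h₁ : σ s12.1 * T = -(T * σ s12.1)) (h₂ : T * T = 0)
    (h₃ : T * conj12 σ T s23 + conj12 σ T s13 * T + conj12 σ T s23 * conj12 σ T s13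
      = l • (1 - σ (s12.1 * s23.1)))

theorem colRep_lift12_H (t : S3) (p : Fin n → k) :
    colRep (Alg.lift12 l σ T h₁ h₂ h₃) (Alg.H l t) p = (σ t).mulVec p := by
  simp [colRep, Alg.lift12]

theorem colRep_lift12_a (p : Fin n → k) :
    colRep (Alg.lift12 l σ T h₁ h₂ h₃) (Alg.a l s12) p = T.mulVec p := by
  simp [colRep, Alg.lift12, conj12_s12]

end lift12

theorem repP_H12 (I : k) (hI : I ^ 2 = -1) (p : Fin 6 → k) :
    repP I hI (Alg.H 1 s12.1) p = ![p 0, -p 1, p 3, p 2, p 5, p 4] := by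
  rw [repP, colRep_lift12_H, grp6_apply, st_s12, sg_transp]
  ext i; fin_cases i <;> simp [Matrix.mulVec, dotProduct, Fin.sum_univ_succ]

theorem repP_H23 (I : k) (hI : I ^ 2 = -1) (p : Fin 6 → k) :
    repP I hI (Alg.H 1 s23.1) p = ![p 0, -p 1, p 2, -p 2 - p 3, p 4, -p 4 - p 5] := by
  rw [repP, colRep_lift12_H, grp6_apply, st_s23, sg_transp]
  ext i; fin_cases i <;> simp [Matrix.mulVec, dotProduct, Fin.sum_univ_succ] <;> ring

theorem repP_a12 (I : k) (hI : I ^ 2 = -1) (p : Fin 6 → k) :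
    repP I hI (Alg.a 1 s12) p = ![p 1 + p 4 - p 5, -2 * I * (p 4 + p 5),
      2 * I * p 0 + p 1 - I * (p 2 + p 3) + p 4 - p 5,
      -2 * I * p 0 + p 1 + I * (p 2 + p 3) + p 4 - p 5, I * (p 4 + p 5), -I * (p 4 + p 5)] := by
  rw [repP, colRep_lift12_a, mat6]
  ext i; fin_cases i <;> simp [Matrix.mulVec, dotProduct, Fin.sum_univ_succ] <;> ring

theorem MnegI_H12 (I : k) (hI : I ^ 2 = -1) (p : Fin 4 → k) :
    MnegI I hI (Alg.H 1 s12.1) p = ![p 0, -p 1, p 3, p 2] := by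
  rw [MnegI, colRep_lift12_H, grp4_apply, st_s12, sg_transp]
  ext i; fin_cases i <;> simp [Matrix.mulVec, dotProduct, Fin.sum_univ_succ]

theorem MnegI_H23 (I : k) (hI : I ^ 2 = -1) (p : Fin 4 → k) :
    MnegI I hI (Alg.H 1 s23.1) p = ![p 0, -p 1, p 2, -p 2 - p 3] := by
  rw [MnegI, colRep_lift12_H, grp4_apply, st_s23, sg_transp]
  ext i; fin_cases i <;> simp [Matrix.mulVec, dotProduct, Fin.sum_univ_succ]; ring

theorem MnegI_a12 (I : k) (hI : I ^ 2 = -1) (p : Fin 4 → k) :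
    MnegI I hI (Alg.a 1 s12) p = ![p 1, 0, 2 * I * p 0 + p 1 - I * (p 2 + p 3),
      -2 * I * p 0 + p 1 + I * (p 2 + p 3)] := by
  rw [MnegI, colRep_lift12_a, mat4]
  ext i; fin_cases i <;> simp [Matrix.mulVec, dotProduct, Fin.sum_univ_succ] <;> ring

theorem stMod_H12 (c d : k) (h : c ^ 2 = d ^ 2) (h' : 5 * c ^ 2 + 4 * (c * d) = -1)
    (p : Fin 2 → k) : stMod c d h h' (Alg.H 1 s12.1) p = ![p 1, p 0] := by
  rw [stMod, colRep_lift12_H, st_s12]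
  ext i; fin_cases i <;> simp [Matrix.mulVec, dotProduct, Fin.sum_univ_succ]

theorem stMod_H23 (c d : k) (h : c ^ 2 = d ^ 2) (h' : 5 * c ^ 2 + 4 * (c * d) = -1)
    (p : Fin 2 → k) : stMod c d h h' (Alg.H 1 s23.1) p = ![p 0, -p 0 - p 1] := by
  rw [stMod, colRep_lift12_H, st_s23]
  ext i; fin_cases i <;> simp [Matrix.mulVec, dotProduct, Fin.sum_univ_succ]; ring

theorem stMod_a12 (c d : k) (h : c ^ 2 = d ^ 2) (h' : 5 * c ^ 2 + 4 * (c * d) = -1)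
    (p : Fin 2 → k) : stMod c d h h' (Alg.a 1 s12) p
      = ![c * p 0 - d * p 1, d * p 0 - c * p 1] := by
  rw [stMod, colRep_lift12_a]
  ext i; fin_cases i <;> simp [Matrix.mulVec, dotProduct, Fin.sum_univ_succ] <;> ring

theorem isStructureP_repP (I : k) (hI : I ^ 2 = -1) : IsStructureP I hI (repP I hI) where
  group t := by
    refine LinearMap.ext fun p => ?_
    rw [repP, colRep_lift12_H, Matrix.toLin'_apply]
  sub z c := by
    symm
    apply Alg.intertwines (inclU k)
    · intro c; rw [MnegI_H12, repP_H12]; ext i; fin_cases i <;> simp [inclU]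
    · intro c; rw [MnegI_H23, repP_H23]; ext i; fin_cases i <;> simp [inclU]
    · intro c; rw [MnegI_a12, repP_a12]; ext i; fin_cases i <;> simp [inclU]
  a12_v := by
    rw [repP_a12]; ext i; fin_cases i <;> simp

theorem IsStructureP.eq_repP {I : k} {hI : I ^ 2 = -1}
    {ρ : Alg (1 : k) →ₐ[k] Module.End k (Fin 6 → k)} (hρ : IsStructureP I hI ρ) :
    ρ = repP I hI := by
  have hH : ∀ t, ρ (Alg.H 1 t) = repP I hI (Alg.H 1 t) := fun t =>
    (hρ.group t).trans ((isStructureP_repP I hI).group t).symm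
  have hv : ρ (Alg.a 1 s12) ![0, 0, 0, 0, 1, 0] = repP I hI (Alg.a 1 s12) ![0, 0, 0, 0, 1, 0] :=
    hρ.a12_v.trans (isStructureP_repP I hI).a12_v.symm
  -- Since w is the image of v under $H_{12}$, which anticommutes with $a_{12}$, the value on v
  -- forces the value on w.
  have hw : ∀ {σ : Alg (1 : k) →ₐ[k] Module.End k (Fin 6 → k)}, IsStructureP I hI σ →
      σ (Alg.a 1 s12) ![0, 0, 0, 0, 0, 1]
        = -repP I hI (Alg.H 1 s12.1) (σ (Alg.a 1 s12) ![0, 0, 0, 0, 1, 0]) := by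
    intro σ hσ
    have e := (isActionTriple σ).h_T ![0, 0, 0, 0, 1, 0]
    rw [hσ.group, ← (isStructureP_repP I hI).group, repP_H12 I hI ![0, 0, 0, 0, 1, 0]] at e
    rw [e, neg_neg]
    simp
  have ha : ρ (Alg.a 1 s12) = repP I hI (Alg.a 1 s12) := by
    refine LinearMap.ext fun p => ?_
    have hp : p = inclU k ![p 0, p 1, p 2, p 3] + p 4 • ![0, 0, 0, 0, 1, 0]
        + p 5 • ![0, 0, 0, 0, 0, 1] := by
      ext i; fin_cases i <;> simp [inclU]
    rw [hp]
    simp only [map_add, map_smul]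
    rw [hρ.sub, (isStructureP_repP I hI).sub, hw hρ, hw (isStructureP_repP I hI), hv]
  refine Alg.hom_ext 1 hH fun i => ?_
  rw [Alg.a_eq_conj12]
  change ρ (Alg.H 1 _ * _ * Alg.H 1 _) = repP I hI (Alg.H 1 _ * _ * Alg.H 1 _)
  simp only [map_mul, hH, ha]

end ModuleP

/-! ### P is the projective cover of $S_{\mathrm{st}}(\mathrm{i})$ -/

section Covers

variable {k : Type*} [Field k]

/-- The homomorphism of modules that is given by an intertwining operator. -/
def RepMod.hom {A V W : Type*} [Ring A] [Algebra k A] [AddCommGroup V] [Module k V]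
    [AddCommGroup W] [Module k W] {ρ : A →ₐ[k] Module.End k V} {σ : A →ₐ[k] Module.End k W}
    (s : V →ₗ[k] W) (hs : ∀ z v, s (ρ z v) = σ z (s v)) : RepMod ρ →ₗ[A] RepMod σ where
  toFun p := RepMod.of σ (s ((RepMod.of ρ).symm p))
  map_add' p q := by simp
  map_smul' z p := congr_arg (RepMod.of σ) (hs z ((RepMod.of ρ).symm p))

/-- The vectors that lie in a submodule, as a subspace. -/
def RepMod.subspace {A V : Type*} [Ring A] [Algebra k A] [AddCommGroup V] [Module k V]
    {ρ : A →ₐ[k] Module.End k V} (N : Submodule A (RepMod ρ)) : Submodule k V where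
  carrier := {v | RepMod.of ρ v ∈ N}
  add_mem' {v w} hv hw := by
    exact N.add_mem hv hw
  zero_mem' := N.zero_mem
  smul_mem' r v hv := by
    have e : RepMod.of ρ (ρ (algebraMap k A r) v) ∈ N := N.smul_mem _ hv
    rwa [AlgHom.commutes, Module.algebraMap_end_apply] at e

theorem RepMod.apply_mem_subspace {A V : Type*} [Ring A] [Algebra k A] [AddCommGroup V]
    [Module k V] {ρ : A →ₐ[k] Module.End k V} {N : Submodule A (RepMod ρ)} (z : A) {v : V}
    (hv : v ∈ RepMod.subspace N) : ρ z v ∈ RepMod.subspace N :=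
  N.smul_mem z hv

theorem projTriv_mem {N : Type*} [AddCommGroup N] [Module k N] {h g : Module.End k N}
    {U : Submodule k N} (hh : ∀ n ∈ U, h n ∈ U) (hg : ∀ n ∈ U, g n ∈ U) {n : N} (hn : n ∈ U) :
    projTriv h g n ∈ U := by
  have h1 := hh n hn
  have g1 := hg n hn
  exact U.smul_mem _ (U.add_mem (U.add_mem (U.add_mem (U.add_mem (U.add_mem hn h1) g1)
    (hh _ g1)) (hg _ h1)) (hh _ (hg _ h1)))

theorem projSgn_mem {N : Type*} [AddCommGroup N] [Module k N] {h g : Module.End k N}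
    {U : Submodule k N} (hh : ∀ n ∈ U, h n ∈ U) (hg : ∀ n ∈ U, g n ∈ U) {n : N} (hn : n ∈ U) :
    projSgn h g n ∈ U := by
  have h1 := hh n hn
  have g1 := hg n hn
  exact U.smul_mem _ (U.sub_mem (U.add_mem (U.add_mem (U.sub_mem (U.sub_mem hn h1) g1)
    (hh _ g1)) (hg _ h1)) (hh _ (hg _ h1)))

theorem projStd_mem {N : Type*} [AddCommGroup N] [Module k N] {h g : Module.End k N}
    {U : Submodule k N} (hh : ∀ n ∈ U, h n ∈ U) (hg : ∀ n ∈ U, g n ∈ U) {n : N} (hn : n ∈ U) :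
    projStd h g n ∈ U := by
  have h1 := hh n hn
  exact U.smul_mem _ (U.sub_mem (U.sub_mem (U.add_mem hn (hg n hn)) (hh _ (hg _ h1)))
    (hg _ h1))

section naturality

variable {N M : Type*} [AddCommGroup N] [Module k N] [AddCommGroup M] [Module k M]
  {h g T : Module.End k N} {h' g' T' : Module.End k M}

theorem map_projStd {r : N →ₗ[k] M} (hh : ∀ n, r (h n) = h' (r n)) (hg : ∀ n, r (g n) = g' (r n))
    (n : N) : r (projStd h g n) = projStd h' g' (r n) := by
  simp [projStd, hh, hg]

/-- The projection is a polynomial in the acting operators, so homomorphisms respect it; this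
carries the chosen element of the regular module to a known vector of P. -/
theorem map_eigenProj {r : N →ₗ[k] M} (hh : ∀ n, r (h n) = h' (r n))
    (hg : ∀ n, r (g n) = g' (r n)) (hT : ∀ n, r (T n) = T' (r n)) (I : k) (n : N) :
    r (eigenProj h g T I n) = eigenProj h' g' T' I (r n) := by
  simp [eigenProj, diffPart, fstPart, sndPart, pow_succ, map_projStd hh hg, hh, hT]

end naturality

theorem projVW_intertwines (I : k) (hI : I ^ 2 = -1) (z : Alg (1 : k)) (p : Fin 6 → k) :
    projVW k (repP I hI z p) = SstI I hI z (projVW k p) := by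
  apply Alg.intertwines (projVW k)
  · intro c; rw [SstI, stMod_H12, repP_H12]; ext i; fin_cases i <;> simp [projVW]
  · intro c; rw [SstI, stMod_H23, repP_H23]; ext i; fin_cases i <;> simp [projVW]
  · intro c; rw [SstI, stMod_a12, repP_a12]; ext i; fin_cases i <;> simp [projVW] <;> ring

variable [CharZero k]

theorem repP_projTriv (I : k) (hI : I ^ 2 = -1) (p : Fin 6 → k) :
    projTriv (repP I hI (Alg.H 1 s12.1)) (repP I hI (Alg.H 1 s23.1)) p
      = ![p 0, 0, 0, 0, 0, 0] := by
  simp only [projTriv, LinearMap.smul_apply, LinearMap.add_apply, Module.End.mul_apply,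
    Module.End.one_apply, repP_H12, repP_H23]
  ext i; fin_cases i <;> simp [Matrix.vecHead, Matrix.vecTail] <;> ring

theorem repP_projSgn (I : k) (hI : I ^ 2 = -1) (p : Fin 6 → k) :
    projSgn (repP I hI (Alg.H 1 s12.1)) (repP I hI (Alg.H 1 s23.1)) p
      = ![0, p 1, 0, 0, 0, 0] := by
  simp only [projSgn, LinearMap.smul_apply, LinearMap.add_apply, LinearMap.sub_apply,
    Module.End.mul_apply, Module.End.one_apply, repP_H12, repP_H23]
  ext i; fin_cases i <;> simp [Matrix.vecHead, Matrix.vecTail] <;> ring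

theorem repP_projStd (I : k) (hI : I ^ 2 = -1) (p : Fin 6 → k) :
    projStd (repP I hI (Alg.H 1 s12.1)) (repP I hI (Alg.H 1 s23.1)) p
      = ![0, 0, p 2, 0, p 4, 0] := by
  simp only [projStd, LinearMap.smul_apply, LinearMap.add_apply, LinearMap.sub_apply,
    Module.End.mul_apply, Module.End.one_apply, repP_H12, repP_H23]
  ext i; fin_cases i <;> simp [Matrix.vecHead, Matrix.vecTail] <;> ring

/-- A submodule of `P` that contains a vector congruent to `v` modulo `k{x, y, u, t}` is all
of `P`. -/
theorem repP_eq_top {I : k} {hI : I ^ 2 = -1} {N : Submodule (Alg (1 : k)) (RepMod (repP I hI))}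
    {p : Fin 6 → k} (hp : RepMod.of _ p ∈ N) (hp4 : p 4 = 1) : N = ⊤ := by
  have hI0 : I ≠ 0 := by rintro rfl; norm_num at hI
  set U := RepMod.subspace N with hU
  have hh : ∀ n ∈ U, repP I hI (Alg.H 1 s12.1) n ∈ U := fun n hn =>
    RepMod.apply_mem_subspace _ hn
  have hg : ∀ n ∈ U, repP I hI (Alg.H 1 s23.1) n ∈ U := fun n hn =>
    RepMod.apply_mem_subspace _ hn
  have hT : ∀ n ∈ U, repP I hI (Alg.a 1 s12) n ∈ U := fun n hn =>
    RepMod.apply_mem_subspace _ hn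
  have h1 : (![0, 0, p 2, 0, 1, 0] : Fin 6 → k) ∈ U := by
    have e := projStd_mem hh hg (show p ∈ U from hp)
    rwa [repP_projStd, hp4] at e
  -- Whatever the coordinate `p 2` is, applying $a_{12}$ gives trivial part x and sign part -2i y;
  -- then $a_{12}x$ yields u.
  have h2 := hT _ h1
  have hx : (![1, 0, 0, 0, 0, 0] : Fin 6 → k) ∈ U := by
    have e := projTriv_mem hh hg h2
    rw [repP_projTriv, repP_a12] at e
    simpa using e
  have hy : (![0, 1, 0, 0, 0, 0] : Fin 6 → k) ∈ U := by
    have e := U.smul_mem (-1 / (2 * I)) (projSgn_mem hh hg h2)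
    rw [repP_projSgn, repP_a12] at e
    convert e using 1
    ext i; fin_cases i <;> simp
    field_simp
  have hu : (![0, 0, 1, 0, 0, 0] : Fin 6 → k) ∈ U := by
    have e := U.smul_mem (1 / (2 * I)) (projStd_mem hh hg (hT _ hx))
    rw [repP_projStd, repP_a12] at e
    convert e using 1
    ext i; fin_cases i <;> simp
    field_simp
  have ht : (![0, 0, 0, 1, 0, 0] : Fin 6 → k) ∈ U := by
    have e := hh _ hu
    rw [repP_H12] at e
    simpa using e
  have hv : (![0, 0, 0, 0, 1, 0] : Fin 6 → k) ∈ U := by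
    have e := U.sub_mem h1 (U.smul_mem (p 2) hu)
    convert e using 1
    ext i; fin_cases i <;> simp
  have hw : (![0, 0, 0, 0, 0, 1] : Fin 6 → k) ∈ U := by
    have e := hh _ hv
    rw [repP_H12] at e
    simpa using e
  rw [eq_top_iff]
  intro q _
  obtain ⟨q, rfl⟩ := (RepMod.of (repP I hI)).surjective q
  change q ∈ U
  have e := U.add_mem (U.add_mem (U.add_mem (U.add_mem (U.add_mem (U.smul_mem (q 0) hx)
    (U.smul_mem (q 1) hy)) (U.smul_mem (q 2) hu)) (U.smul_mem (q 3) ht))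
    (U.smul_mem (q 4) hv)) (U.smul_mem (q 5) hw)
  convert e using 1
  ext i; fin_cases i <;> simp

/-- The basis vector v of P is itself an eigenvector of D for 2i, where the normalised polynomial
takes the value 1. -/
theorem repP_eigenProj (I : k) (hI : I ^ 2 = -1) :
    eigenProj (repP I hI (Alg.H 1 s12.1)) (repP I hI (Alg.H 1 s23.1)) (repP I hI (Alg.a 1 s12)) I
      ![0, 0, 0, 0, 1, 0] = ![0, 0, 0, 0, 1, 0] := by
  have e : diffPart (repP I hI (Alg.H 1 s12.1)) (repP I hI (Alg.H 1 s23.1))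
      (repP I hI (Alg.a 1 s12)) ![0, 0, 0, 0, 1, 0] = (2 * I) • ![0, 0, 0, 0, 1, 0] := by
    simp only [diffPart, fstPart, sndPart, LinearMap.sub_apply, Module.End.mul_apply,
      repP_projStd, repP_H12, repP_a12]
    ext i; fin_cases i <;> simp
    ring
  simp only [eigenProj, pow_succ, pow_zero, one_mul, LinearMap.smul_apply, LinearMap.add_apply,
    Module.End.mul_apply, e, map_smul, smul_smul, ← add_smul]
  rw [show I / 16 * (2 * I * (2 * I * (2 * I)) + 2 * I * (2 * I * (2 * I))) = 1 by
    linear_combination (I ^ 2 - 1) * hI, one_smul]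

theorem projective_repP (I : k) (hI : I ^ 2 = -1) :
    Module.Projective (Alg (1 : k)) (RepMod (repP I hI)) := by
  set σ : Alg (1 : k) →ₐ[k] Module.End k (Alg (1 : k)) := Algebra.lmul k (Alg (1 : k)) with hσ
  have H := isActionTriple σ
  set h := σ (Alg.H 1 s12.1) with hh
  set g := σ (Alg.H 1 s23.1) with hg
  set T := σ (Alg.a 1 s12) with hT
  -- Projecting 1 produces an element that satisfies the relations of P's generator in the left
  -- regular module.
  set v := eigenProj h g T I (projStd h g 1) with hv
  have hvs : IsStd h g v := H.eigenProj_isStd I _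
  obtain ⟨x, y, u, hx, hy, hu, Tx, Ty, Tu, Tv⟩ :=
    H.exists_of_eigenvector I hI hvs (H.diffPart_eigenProj I hI (H.projStd_isStd 1))
  let s : (Fin 6 → k) →ₗ[k] Alg (1 : k) :=
    { toFun := fun p => p 0 • x + p 1 • y + p 2 • u + p 3 • h u + p 4 • v + p 5 • h v
      map_add' := fun p q => by simp only [Pi.add_apply]; module
      map_smul' := fun r p => by simp only [Pi.smul_apply, RingHom.id_apply, smul_eq_mul]; module }
  have hTh : ∀ n, T (h n) = -h (T n) := fun n => by rw [H.h_T, neg_neg]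
  have hs : ∀ z p, s (repP I hI z p) = σ z (s p) := by
    refine Alg.intertwines s (fun p => ?_) (fun p => ?_) (fun p => ?_)
    · rw [← hh, repP_H12]
      simp [s, hx.1, hy.1, H.h_h]
      module
    · rw [← hg, repP_H23]
      simp [s, hx.2, hy.2, hu.1, hu.2, hvs.1, hvs.2]
      module
    · rw [← hT, repP_a12]
      simp [s, hTh, Tx, Ty, Tu, Tv, hx.1, hy.1, H.h_h]
      module
  let i : RepMod (repP I hI) →ₗ[Alg (1 : k)] Alg (1 : k) :=
    { toFun := fun p => s ((RepMod.of (repP I hI)).symm p)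
      map_add' := fun p q => by simp
      map_smul' := fun z p => hs z _ }
  let r := LinearMap.toSpanSingleton (Alg (1 : k)) (RepMod (repP I hI))
    (RepMod.of _ ![0, 0, 0, 0, 1, 0])
  let r' : Alg (1 : k) →ₗ[k] (Fin 6 → k) :=
    { toFun := fun z => repP I hI z ![0, 0, 0, 0, 1, 0]
      map_add' := by simp
      map_smul' := by simp }
  have hr : r' v = ![0, 0, 0, 0, 1, 0] := by
    have e : ∀ z n, r' (σ z n) = repP I hI z (r' n) := fun z n => by simp [r', σ]
    rw [hv, map_eigenProj (e _) (e _) (e _), map_projStd (e _) (e _)]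
    have e1 : r' 1 = ![0, 0, 0, 0, 1, 0] := by simp [r']
    rw [e1, repP_projStd]
    exact repP_eigenProj I hI
  refine Module.Projective.of_split i r ?_
  -- The submodule where the composite agrees with the identity contains the generator v.
  have e : LinearMap.eqLocus (r.comp i) LinearMap.id = ⊤ := by
    refine repP_eq_top (p := ![0, 0, 0, 0, 1, 0]) ?_ rfl
    have e1 : i (RepMod.of _ ![0, 0, 0, 0, 1, 0]) = v := by
      change s ![0, 0, 0, 0, 1, 0] = v
      simp [s]
    change r (i _) = _
    rw [e1]
    exact congr_arg (RepMod.of (repP I hI)) hr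
  ext p
  exact (LinearMap.mem_eqLocus).1 (e ▸ Submodule.mem_top : p ∈ LinearMap.eqLocus _ _)

theorem isProjectiveCover_repP (I : k) (hI : I ^ 2 = -1) :
    IsProjectiveCover (RepMod.hom (projVW k) (projVW_intertwines I hI)) where
  projective := projective_repP I hI
  surjective := by
    intro q
    refine ⟨RepMod.of _ ![0, 0, 0, 0, (RepMod.of _).symm q 0, (RepMod.of _).symm q 1], ?_⟩
    apply (RepMod.of (SstI I hI)).symm.injective
    change ![_, _] = _
    ext i; fin_cases i <;> rfl
  essential N hN := by
    -- A preimage of the first basis vector has v-coordinate 1, hence generates P.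
    have e : RepMod.of (SstI I hI) ![1, 0] ∈ N.map (RepMod.hom _ (projVW_intertwines I hI)) := by
      rw [hN]; trivial
    obtain ⟨p, hp, hp'⟩ := e
    exact repP_eq_top (p := (RepMod.of _).symm p) hp (congr_fun hp' 0)

end Covers

/-! ### Sign twists and tensor products with the sign module -/

section Twist

variable {k : Type*} [Field k]

/-- Projective covers are preserved by twisting with an automorphism of the algebra. -/
theorem IsProjectiveCover.exists_twist {A V V' W W' : Type*} [Ring A] [Algebra k A]
    [AddCommGroup V] [Module k V] [AddCommGroup V'] [Module k V'] [AddCommGroup W] [Module k W]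
    [AddCommGroup W'] [Module k W'] {ρ : A →ₐ[k] Module.End k V} {ρ' : A →ₐ[k] Module.End k V'}
    {σ : A →ₐ[k] Module.End k W} {σ' : A →ₐ[k] Module.End k W'} (φ : A ≃ₐ[k] A)
    (e : V ≃ₗ[k] V') (e' : W ≃ₗ[k] W') (he : ∀ z v, e (ρ (φ z) v) = ρ' z (e v))
    (he' : ∀ z w, e' (σ (φ z) w) = σ' z (e' w)) {f : RepMod ρ →ₗ[A] RepMod σ}
    (hf : IsProjectiveCover f) :
    ∃ f' : RepMod ρ' →ₗ[A] RepMod σ', IsProjectiveCover f' := by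
  have hs : ∀ z v, e.symm (ρ' z v) = ρ (φ z) (e.symm v) := by
    intro z v
    rw [LinearEquiv.symm_apply_eq, he, LinearEquiv.apply_symm_apply]
  let f' : RepMod ρ' →ₗ[A] RepMod σ' :=
    { toFun := fun p => RepMod.of σ' (e' ((RepMod.of σ).symm (f (RepMod.of ρ
        (e.symm ((RepMod.of ρ').symm p))))))
      map_add' := fun p q => by simp
      map_smul' := fun z p => by
        have e1 : RepMod.of ρ (e.symm ((RepMod.of ρ').symm (z • p)))
            = φ z • RepMod.of ρ (e.symm ((RepMod.of ρ').symm p)) :=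
          congr_arg (RepMod.of ρ) (hs z ((RepMod.of ρ').symm p))
        rw [e1, map_smul]
        exact congr_arg (RepMod.of σ') (he' z _) }
  refine ⟨f', ?_, ?_, ?_⟩
  · have := hf.projective
    have : RingHomInvPair (φ.symm.toRingEquiv : A →+* A) (φ.symm.toRingEquiv.symm : A →+* A) :=
      RingHomInvPair.of_ringEquiv _
    have : RingHomInvPair (φ.symm.toRingEquiv.symm : A →+* A) (φ.symm.toRingEquiv : A →+* A) :=
      RingHomInvPair.of_ringEquiv_symm _
    -- The two modules differ only by the automorphism, so e is a semilinear isomorphism, and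
    -- projectivity passes along it.
    let E : RepMod ρ ≃ₛₗ[(φ.symm.toRingEquiv : A →+* A)] RepMod ρ' :=
      { toFun := fun p => RepMod.of ρ' (e ((RepMod.of ρ).symm p))
        invFun := fun p => RepMod.of ρ (e.symm ((RepMod.of ρ').symm p))
        left_inv := fun p => by simp
        right_inv := fun p => by simp
        map_add' := fun p q => by simp
        map_smul' := fun z p => by
          have e1 := he (φ.symm z) ((RepMod.of ρ).symm p)
          rw [AlgEquiv.apply_symm_apply] at e1
          exact congr_arg (RepMod.of ρ') e1 }
    exact Module.Projective.of_equiv E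
  · intro q
    obtain ⟨p, hp⟩ := hf.surjective (RepMod.of σ (e'.symm ((RepMod.of σ').symm q)))
    refine ⟨RepMod.of ρ' (e ((RepMod.of ρ).symm p)), ?_⟩
    simp [f', hp]
  · intro N hN
    let N' : Submodule A (RepMod ρ) :=
      { carrier := {p | RepMod.of ρ' (e ((RepMod.of ρ).symm p)) ∈ N}
        add_mem' := fun {p q} hp hq => by
          have := N.add_mem hp hq
          simpa using this
        zero_mem' := by simp
        smul_mem' := fun z p hp => by
          have e1 := he (φ.symm z) ((RepMod.of ρ).symm p)
          rw [AlgEquiv.apply_symm_apply] at e1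
          have e2 := N.smul_mem (φ.symm z) hp
          rw [RepMod.smul_of, ← e1] at e2
          exact e2 }
    have hN' : N' = ⊤ := by
      apply hf.essential
      rw [eq_top_iff]
      intro q _
      have hq : RepMod.of σ' (e' ((RepMod.of σ).symm q)) ∈ N.map f' := by rw [hN]; trivial
      obtain ⟨p, hp, hp'⟩ := hq
      refine ⟨RepMod.of ρ (e.symm ((RepMod.of ρ').symm p)), ?_, ?_⟩
      · change RepMod.of ρ' (e ((RepMod.of ρ).symm _)) ∈ N
        simpa using hp
      · simpa [f'] using hp'
    rw [eq_top_iff]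
    intro p _
    have hp : RepMod.of ρ (e.symm ((RepMod.of ρ').symm p)) ∈ N' := by rw [hN']; trivial
    have hp' : RepMod.of ρ' (e ((RepMod.of ρ).symm
      (RepMod.of ρ (e.symm ((RepMod.of ρ').symm p))))) ∈ N := hp
    simpa using hp'

theorem sg_mul_self (t : S3) : sg k t * sg k t = 1 := by
  rcases Int.units_eq_one_or (Equiv.Perm.sign t) with h | h <;> simp [sg, h]

/-- The endomorphism `H_t ↦ sgn(t) H_t`, `a_i ↦ c a_i`, where `c ^ 2 = 1`. -/
def signTwistHom (c : k) (hc : c * c = 1) : Alg (1 : k) →ₐ[k] Alg (1 : k) :=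
  Alg.lift 1
    { toFun := fun t => sg k t • Alg.H 1 t
      map_one' := by simp [Alg.H_one]
      map_mul' := fun t s => by rw [smul_mul_smul_comm, Alg.H_mul, map_mul] }
    (fun i => c • Alg.a 1 i)
    (by
      intro t i
      simp only [MonoidHom.coe_mk, OneHom.coe_mk, smul_mul_smul_comm, Alg.H_a, smul_smul]
      congr 1
      ring)
    (by intro i; rw [smul_mul_smul_comm, Alg.a_sq, smul_zero])
    (by
      intro i j hij
      have e : sg k (i.1 * j.1) = 1 := by rw [map_mul, sg_transp, sg_transp]; ring
      simp only [MonoidHom.coe_mk, OneHom.coe_mk, smul_mul_smul_comm, hc, one_smul, e]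
      simpa using Alg.a_quad (1 : k) i j hij)

theorem signTwistHom_H (c : k) (hc : c * c = 1) (t : S3) :
    signTwistHom c hc (Alg.H 1 t) = sg k t • Alg.H 1 t := by
  simp [signTwistHom]

theorem signTwistHom_a (c : k) (hc : c * c = 1) (i : Transp) :
    signTwistHom c hc (Alg.a 1 i) = c • Alg.a 1 i := by
  simp [signTwistHom]

theorem signTwistHom_comp (c : k) (hc : c * c = 1) :
    (signTwistHom c hc).comp (signTwistHom c hc) = AlgHom.id k _ :=
  Alg.hom_ext 1
    (fun t => by simp [signTwistHom_H, smul_smul, sg_mul_self])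
    (fun i => by simp [signTwistHom_a, smul_smul, hc])

/-- The involution `H_t ↦ sgn(t) H_t`, `a_i ↦ c a_i`, where `c ^ 2 = 1`. -/
def signTwist (c : k) (hc : c * c = 1) : Alg (1 : k) ≃ₐ[k] Alg (1 : k) :=
  AlgEquiv.ofAlgHom (signTwistHom c hc) (signTwistHom c hc) (signTwistHom_comp c hc)
    (signTwistHom_comp c hc)

theorem signTwist_H (c : k) (hc : c * c = 1) (t : S3) :
    signTwist c hc (Alg.H 1 t) = sg k t • Alg.H 1 t :=
  signTwistHom_H c hc t

theorem signTwist_a (c : k) (hc : c * c = 1) (i : Transp) :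
    signTwist c hc (Alg.a 1 i) = c • Alg.a 1 i :=
  signTwistHom_a c hc i

theorem Ssg_H (t : S3) (r : k) : Ssg k (Alg.H 1 t) r = sg k t * r := by
  simp [Ssg, Alg.lift12]

theorem Ssg_a (r : k) : Ssg k (Alg.a 1 s12) r = 0 := by
  simp [Ssg, Alg.lift12, conj12]

section tensor

variable {V W : Type*} [AddCommGroup V] [Module k V] [AddCommGroup W] [Module k W]
  (ρ : Alg (1 : k) →ₐ[k] Module.End k V) (σ : Alg (1 : k) →ₐ[k] Module.End k W)

theorem tensorRep_H (t : S3) (v : V) (w : W) : tensorRep ρ σ (Alg.H 1 t) (v ⊗ₜ[k] w)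
    = ρ (Alg.H 1 t) v ⊗ₜ[k] σ (Alg.H 1 t) w := by
  have e : Bialgebra.comulAlgHom k (Alg (1 : k)) (Alg.H 1 t) = _ := Alg.comul_H 1 t
  simp only [tensorRep, AlgHom.comp_apply, e, Algebra.TensorProduct.map_tmul]
  rfl

theorem tensorRep_a (i : Transp) (v : V) (w : W) : tensorRep ρ σ (Alg.a 1 i) (v ⊗ₜ[k] w)
    = ρ (Alg.H 1 i.1) v ⊗ₜ[k] σ (Alg.a 1 i) w + ρ (Alg.a 1 i) v ⊗ₜ[k] w := by
  have e : Bialgebra.comulAlgHom k (Alg (1 : k)) (Alg.a 1 i) = _ := Alg.comul_a 1 i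
  simp only [tensorRep, AlgHom.comp_apply, e, map_add, Algebra.TensorProduct.map_tmul, map_one]
  rfl

/-- Only the summand $a_\sigma\otimes 1$ of the comultiplication survives, because $a_\sigma$ kills
the sign module; hence the twist with coefficient 1. -/
theorem tensorRep_Ssg (z : Alg (1 : k)) (v : V) :
    (TensorProduct.rid k V).symm (ρ (signTwist 1 (one_mul 1) z) v)
      = tensorRep ρ (Ssg k) z ((TensorProduct.rid k V).symm v) := by
  refine Alg.intertwines (ρ := ρ.comp (signTwist 1 (one_mul 1)).toAlgHom)
    (TensorProduct.rid k V).symm.toLinearMap (fun v => ?_) (fun v => ?_) (fun v => ?_) z v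
  · simp [signTwist_H, tensorRep_H, Ssg_H, sg_transp, TensorProduct.tmul_neg,
      TensorProduct.neg_tmul]
  · simp [signTwist_H, tensorRep_H, Ssg_H, sg_transp, TensorProduct.tmul_neg,
      TensorProduct.neg_tmul]
  · simp [signTwist_a, tensorRep_a, Ssg_a]

/-- Now only $H_\sigma\otimes a_\sigma$ survives, and $H_\sigma$ acts by -1 on the sign module;
hence the coefficient -1. -/
theorem Ssg_tensorRep (z : Alg (1 : k)) (v : V) :
    (TensorProduct.lid k V).symm (ρ (signTwist (-1) (by ring) z) v)
      = tensorRep (Ssg k) ρ z ((TensorProduct.lid k V).symm v) := by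
  refine Alg.intertwines (ρ := ρ.comp (signTwist (-1) (by ring)).toAlgHom)
    (TensorProduct.lid k V).symm.toLinearMap (fun v => ?_) (fun v => ?_) (fun v => ?_) z v
  · simp [signTwist_H, tensorRep_H, Ssg_H, sg_transp, TensorProduct.tmul_neg,
      TensorProduct.neg_tmul]
  · simp [signTwist_H, tensorRep_H, Ssg_H, sg_transp, TensorProduct.tmul_neg,
      TensorProduct.neg_tmul]
  · simp [signTwist_a, tensorRep_a, Ssg_H, Ssg_a, sg_transp, TensorProduct.tmul_neg,
      TensorProduct.neg_tmul]

end tensor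

variable [CharZero k]

/-- The isomorphism of `W_st` with its twist by the sign. -/
def stSignEquiv (k : Type*) [Field k] [CharZero k] : (Fin 2 → k) ≃ₗ[k] (Fin 2 → k) where
  toFun p := ![p 0 + 2 * p 1, -2 * p 0 - p 1]
  -- The map squares to -3, so its inverse is -1/3 times itself.
  invFun p := ![-(p 0 + 2 * p 1) / 3, (2 * p 0 + p 1) / 3]
  map_add' p q := by ext i; fin_cases i <;> simp <;> ring
  map_smul' r p := by ext i; fin_cases i <;> simp <;> ring
  left_inv p := by ext i; fin_cases i <;> simp <;> ring
  right_inv p := by ext i; fin_cases i <;> simp <;> ring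

/-- The twists of the modules supported on `W_st`. -/
theorem stMod_signTwist {c d c' d' : k} {h : c ^ 2 = d ^ 2} {h' : 5 * c ^ 2 + 4 * (c * d) = -1}
    {g : c' ^ 2 = d' ^ 2} {g' : 5 * c' ^ 2 + 4 * (c' * d') = -1} (r : k) (hr : r * r = 1)
    (e₁ : 3 * c' = -r * (5 * c + 4 * d)) (e₂ : 3 * d' = r * (4 * c + 5 * d))
    (z : Alg (1 : k)) (p : Fin 2 → k) :
    stSignEquiv k (stMod c d h h' (signTwist r hr z) p)
      = stMod c' d' g g' z (stSignEquiv k p) := by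
  refine Alg.intertwines (ρ := (stMod c d h h').comp (signTwist r hr).toAlgHom)
    (stSignEquiv k).toLinearMap (fun p => ?_) (fun p => ?_) (fun p => ?_) z p
  · simp [signTwist_H, sg_transp, stMod_H12]
    ext i; fin_cases i <;> simp [stSignEquiv] <;> ring
  · simp [signTwist_H, sg_transp, stMod_H23]
    ext i; fin_cases i <;> simp [stSignEquiv] <;> ring
  · simp [signTwist_a, stMod_a12]
    ext i; fin_cases i <;> simp [stSignEquiv]
    · linear_combination (-(p 0 + 2 * p 1) / 3) * e₁ - ((2 * p 0 + p 1) / 3) * e₂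
    · linear_combination (-(p 0 + 2 * p 1) / 3) * e₂ - ((2 * p 0 + p 1) / 3) * e₁

end Twist

end PointedS3

end

open PointedS3 in
theorem mainTheorem4 {k : Type*} [Field k] [IsAlgClosed k] [CharZero k]
    (I : k) (hI : I ^ 2 = -1) :
    ∃ ρ : Alg (1 : k) →ₐ[k] Module.End k (Fin 6 → k),
      IsStructureP I hI ρ ∧
      (∀ ρ' : Alg (1 : k) →ₐ[k] Module.End k (Fin 6 → k), IsStructureP I hI ρ' → ρ' = ρ) ∧
      (∃ (j : RepMod (MnegI I hI) →ₗ[Alg (1 : k)] RepMod ρ)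
          (π : RepMod ρ →ₗ[Alg (1 : k)] RepMod (SstI I hI)),
        (∀ c, j (RepMod.of _ c) = RepMod.of _ (inclU k c)) ∧
        (∀ p, π (RepMod.of _ p) = RepMod.of _ (projVW k p)) ∧
        Function.Injective j ∧ Function.Exact j π ∧ IsProjectiveCover π) ∧
      (∃ f : RepMod (tensorRep ρ (Ssg k)) →ₗ[Alg (1 : k)] RepMod (SstNegThird I hI),
        IsProjectiveCover f) ∧
      (∃ f : RepMod (tensorRep (Ssg k) ρ) →ₗ[Alg (1 : k)] RepMod (SstThird I hI),
        IsProjectiveCover f) ∧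
      (∃ f : RepMod (tensorRep (tensorRep (Ssg k) ρ) (Ssg k)) →ₗ[Alg (1 : k)]
          RepMod (SstNegI I hI),
        IsProjectiveCover f) := by
  have hcover := isProjectiveCover_repP I hI
  obtain ⟨f, hf⟩ : ∃ f : RepMod (tensorRep (Ssg k) (repP I hI)) →ₗ[Alg (1 : k)]
      RepMod (SstThird I hI), IsProjectiveCover f :=
    hcover.exists_twist (signTwist (-1) (by ring)) (TensorProduct.lid k _).symm (stSignEquiv k)
      (Ssg_tensorRep _) (stMod_signTwist (-1) (by ring) (by ring) (by ring))
  refine ⟨repP I hI, isStructureP_repP I hI, fun ρ' hρ' => hρ'.eq_repP,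
    ⟨RepMod.hom (inclU k) fun z c => ((isStructureP_repP I hI).sub z c).symm,
      RepMod.hom (projVW k) (projVW_intertwines I hI), fun c => rfl, fun p => rfl, ?_, ?_,
      hcover⟩, ?_, ⟨f, hf⟩, ?_⟩
  · intro c d hcd
    have e (i : Fin 6) : inclU k ((RepMod.of _).symm c) i = inclU k ((RepMod.of _).symm d) i :=
      congr_fun hcd i
    apply (RepMod.of (MnegI I hI)).symm.injective
    ext i
    fin_cases i
    · exact e 0
    · exact e 1
    · exact e 2
    · exact e 3
  · intro p
    constructor
    · intro hp
      have e4 : (RepMod.of (repP I hI)).symm p 4 = 0 := congr_fun hp 0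
      have e5 : (RepMod.of (repP I hI)).symm p 5 = 0 := congr_fun hp 1
      refine ⟨RepMod.of _ fun i : Fin 4 => (RepMod.of (repP I hI)).symm p (i.castLE (by decide)),
        ?_⟩
      apply (RepMod.of (repP I hI)).symm.injective
      ext i
      fin_cases i
      · rfl
      · rfl
      · rfl
      · rfl
      · exact e4.symm
      · exact e5.symm
    · rintro ⟨c, rfl⟩
      apply (RepMod.of (SstI I hI)).symm.injective
      ext i
      fin_cases i <;> rfl
  · exact hcover.exists_twist (signTwist 1 (one_mul 1)) (TensorProduct.rid k _).symm
      (stSignEquiv k) (tensorRep_Ssg _) (stMod_signTwist 1 (one_mul 1) (by ring) (by ring))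
  -- The two-sided tensor product is the right twist of the cover already obtained by the left
  -- twist, and this twist takes i/3 to -i.
  · exact hf.exists_twist (signTwist 1 (one_mul 1)) (TensorProduct.rid k _).symm
      (stSignEquiv k) (tensorRep_Ssg _) (stMod_signTwist 1 (one_mul 1) (by ring) (by ring))
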